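/- For $0<\beta<\alpha<1$ the Bruin–Troubetzkoy interval translation mapping (BT ITM) $T=T_{\alpha,\beta}:[0,1)\to[0,1)$ is \[ T(x)=\begin{cases}x+\alpha,& x\in[0,1-\alpha),\\ x+\beta,& x\in[1-\alpha,1-\beta),\\ x+\beta-1,& x\in[1-\beta,1).\end{cases} \] It is of infinite type if the decreasing sequence of sets $\Omega_n=\bigcap_{0\le j\le n}T^j([0,1))$ is not eventually constant. Theorem. There exists a BT ITM $T$ of infinite type which has exactly one invariant Borel probability measure $\mu$; this measure is generated by Lebesgue measure, in the sense that $\frac1n\sum_{j=0}^{n-1}(T^j)_*\mathrm{Leb}\to\mu$ weakly on $[0,1)$; and there is an irrational number $\gamma$ such that the system $([0,1),\mu,T)$ is measure-theoretically isomorphic to the rotation $x\mapsto x+\gamma$ of $\mathbb R/\mathbb Z$ equipped with Lebesgue (Haar) measure. In particular, $e^{2\pi i\gamma}$ is an eigenvalue of $([0,1),\mu,T)$ with a measurable eigenfunction, $([0,1),\mu,T)$ has discrete spectrum (the eigenfunctions in $L^2(\mu;\mathbb C)$ span a dense subspace), and it is not weakly mixing. -/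

import Mathlib

open MeasureTheory Filter Topology BoundedContinuousFunction

namespace BTITM

/-! ### General notions for a self-map of a measurable space -/

section General

variable {X Y : Type*}

/-- The level `n` attractor `X ∩ T X ∩ ⋯ ∩ Tⁿ X` of a self-map `T` of `X`. -/
def attractor (T : X → X) (n : ℕ) : Set X :=
  ⋂ j ∈ Finset.range (n + 1), T^[j] '' Set.univ

/-- The sequence of attractors stabilises. -/
def IsFiniteType (T : X → X) : Prop :=
  ∃ N : ℕ, ∀ k, N ≤ k → attractor T k = attractor T (k + 1)

/-- The sequence of attractors does not stabilise. -/
def IsInfiniteType (T : X → X) : Prop := ¬ IsFiniteType T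

variable [MeasurableSpace X] [MeasurableSpace Y]

/-- Measure-theoretic isomorphism of the systems `(X, μ, T)` and `(Y, ν, S)`: after removing null
sets, there is an equivariant, bimeasurable, measure preserving bijection `φ` with inverse `ψ`. -/
def MeasureIsomorphic (T : X → X) (μ : Measure X) (S : Y → Y) (ν : Measure Y) : Prop :=
  ∃ (X₀ : Set X) (Y₀ : Set Y) (φ : X → Y) (ψ : Y → X),
    MeasurableSet X₀ ∧ MeasurableSet Y₀ ∧ μ X₀ᶜ = 0 ∧ ν Y₀ᶜ = 0 ∧
    Set.MapsTo T X₀ X₀ ∧ Set.MapsTo S Y₀ Y₀ ∧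
    MeasurePreserving φ μ ν ∧ MeasurePreserving ψ ν μ ∧
    Set.MapsTo φ X₀ Y₀ ∧ Set.MapsTo ψ Y₀ X₀ ∧ Set.InvOn ψ φ X₀ Y₀ ∧
    ∀ x ∈ X₀, φ (T x) = S (φ x)

/-- `c` is an eigenvalue of `(X, μ, T)` with a measurable eigenfunction. -/
def IsMeasurableEigenvalue (T : X → X) (μ : Measure X) (c : ℂ) : Prop :=
  ∃ f : X → ℂ, Measurable f ∧ (¬ f =ᵐ[μ] 0) ∧ ∀ᵐ x ∂μ, f (T x) = c * f x

/-- The `L²` eigenfunctions of `(X, μ, T)` span a dense subspace of `L²(μ; ℂ)`. -/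
def HasDiscreteSpectrum (T : X → X) (μ : Measure X) : Prop :=
  (Submodule.span ℂ
    {f : Lp ℂ 2 μ | ∃ c : ℂ, ∀ᵐ x ∂μ, f (T x) = c * f x}).topologicalClosure = ⊤

/-- Weak mixing of `(X, μ, T)`: the product `T × T` is ergodic for `μ × μ`. -/
def IsWeaklyMixing (T : X → X) (μ : Measure X) : Prop :=
  Ergodic (Prod.map T T) (μ.prod μ)

end General

/-! ### Bruin–Troubetzkoy interval translation mappings -/

/-- The interval `[0, 1)`. -/
abbrev I : Type := Set.Ico (0 : ℝ) 1

/-- Lebesgue measure on `[0, 1)`. -/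
noncomputable def lebesgue : Measure I := Measure.comap Subtype.val volume

/-- The interior points `(α, β)` of the triangle `1 ≥ α ≥ β ≥ 0`. -/
structure Param where
  α : ℝ
  β : ℝ
  β_pos : 0 < β
  β_lt_α : β < α
  α_lt_one : α < 1

/-- The formula for the Bruin–Troubetzkoy map. -/
noncomputable def formula (α β x : ℝ) : ℝ :=
  if x < 1 - α then x + α else if x < 1 - β then x + β else x + β - 1

theorem formula_mem (p : Param) {x : ℝ} (hx : x ∈ Set.Ico (0 : ℝ) 1) :
    formula p.α p.β x ∈ Set.Ico (0 : ℝ) 1 := by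
  obtain ⟨h0, h1⟩ := hx
  have h2 := p.β_pos
  have h3 := p.β_lt_α
  have h4 := p.α_lt_one
  unfold formula
  split_ifs <;> constructor <;> linarith

/-- The Bruin–Troubetzkoy interval translation mapping `T_{α,β} : [0, 1) → [0, 1)`. -/
noncomputable def Param.map (p : Param) (x : I) : I :=
  ⟨formula p.α p.β x, formula_mem p x.2⟩

/-- The averages `(1/n) ∑_{j < n} (Tʲ)₊ Leb` of the images of Lebesgue measure under `T` converge
weakly to `μ`. -/
def IsLimitOfLebesgue (T : I → I) (μ : Measure I) : Prop :=
  ∀ f : I →ᵇ ℝ,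
    Tendsto (fun n : ℕ => (n : ℝ)⁻¹ * ∑ j ∈ Finset.range n, ∫ x, f (T^[j] x) ∂lebesgue)
      atTop (𝓝 (∫ x, f x ∂μ))

/-- The rotation of the circle `ℝ/ℤ` by the angle `γ`. -/
noncomputable def rotation (γ : ℝ) (x : UnitAddCircle) : UnitAddCircle :=
  x + (γ : UnitAddCircle)

end BTITM

namespace BTITM

/-! ### Return times and continued fraction denominators -/

/-! The map is chosen infinitely renormalisable: its first return to `[1 - lam m, 1)` again has
three branches, with return times `ht m`, `hh m`, `hc m`. Each branch of level `m + 1` runs once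
through the third branch of level `m`, then repeatedly through the first, then perhaps through the
second, as `rep₁ m` and `rep₂ m` prescribe (`Widths.level`). Compactness supplies widths with the
prescribed repetitions (`nonempty_widths`).

The repetitions are tuned. On even levels `rep₁ m = hh m`: being positive it keeps the widths
nondegenerate, and being a multiple of `hh m` it lets `hh`, `hc` evolve as denominators of a
backward continued fraction, so `hh m * gam` is close to the integer `hp m`. On odd levels `rep₁ m =
0`; together with a huge `rep₂`, this makes every return word of level `m + 2`, `m` even, almost a
power of one word of level `m`. Hence Birkhoff averages of Lipschitz functions are uniformly close
to constants (`Widths.exists_average`), which gives uniqueness of the invariant measure and the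
convergence from Lebesgue measure.

For the isomorphism, a digit sequence codes a point `pt j 0` of the interval and a point `cpt j` of
the circle. On both sides, two forward orbits meet exactly when the entry times `entry j m`
eventually differ by the right constant (`Widths.entry_of_iterate_pt`, `entry_of_cpt` and their
converses). So `cpt j + n • ang ↦ T^[n] (pt j 0)` is well defined, injective and equivariant. Since
`rep₂` is huge, the points `cpt j` form a set of positive measure (`volume_range_cpt_pos`), whose
forward orbit has full measure by ergodicity; `mu` is the image of Haar measure.

Infinite type holds because each renormalised map misses a point of its interval
(`Widths.first_return`). The spectral claims come from pulling back characters of the circle. -/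

/-- The return times `t`, `h`, `c` of the three branches of a renormalised map, together with the
numerators `p`, `d` attached to the denominators `h`, `c`. -/
structure Heights where
  t : ℕ
  h : ℕ
  c : ℕ
  p : ℕ
  d : ℕ

/-- The indicator of the even levels. -/
def evenInd (m : ℕ) : ℕ := if Even m then 1 else 0

/-- The heights of the renormalised maps at each level. -/
def heights : ℕ → Heights
  | 0 => ⟨1, 1, 1, 0, 1⟩
  | m + 1 =>
    let s := heights m
    -- On even levels `s.h` passes of duration `s.t` last as long as `s.t` passes of duration `s.h`.
    -- Counting them as the latter turns the recursion for `h`, `c` into a two-term one with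
    -- quotient `B`.
    let B := 2 ^ (m + 5) * (s.t + 1) + evenInd m * s.t
    ⟨s.c + (evenInd m * s.h + 1) * s.t, s.c + B * s.h + s.h, s.c + B * s.h,
      s.d + B * s.p + s.p, s.d + B * s.p⟩

/-- Return time of the first branch. -/
def ht (m : ℕ) : ℕ := (heights m).t
/-- Return time of the second branch. -/
def hh (m : ℕ) : ℕ := (heights m).h
/-- Return time of the third branch. -/
def hc (m : ℕ) : ℕ := (heights m).c
/-- Numerator attached to `hh`. -/
def hp (m : ℕ) : ℕ := (heights m).p
/-- Numerator attached to `hc`. -/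
def hd (m : ℕ) : ℕ := (heights m).d
/-- One less than the number of repetitions of the first letter. -/
def rep₁ (m : ℕ) : ℕ := evenInd m * hh m
/-- One less than the number of repetitions of the second letter. -/
def rep₂ (m : ℕ) : ℕ := 2 ^ (m + 5) * (ht m + 1)
/-- The partial quotients, diminished by two, of the backward continued fraction. -/
def quot (m : ℕ) : ℕ := rep₂ m + evenInd m * ht m

theorem ht_zero : ht 0 = 1 := rfl
theorem hh_zero : hh 0 = 1 := rfl
theorem hc_zero : hc 0 = 1 := rfl
theorem hp_zero : hp 0 = 0 := rfl
theorem hd_zero : hd 0 = 1 := rfl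
theorem ht_succ (m : ℕ) : ht (m + 1) = hc m + (rep₁ m + 1) * ht m := rfl
theorem hc_succ (m : ℕ) : hc (m + 1) = hc m + quot m * hh m := rfl
theorem hh_succ (m : ℕ) : hh (m + 1) = hc (m + 1) + hh m := rfl
theorem hd_succ (m : ℕ) : hd (m + 1) = hd m + quot m * hp m := rfl
theorem hp_succ (m : ℕ) : hp (m + 1) = hd (m + 1) + hp m := rfl

attribute [irreducible] ht hh hc hp hd

theorem hc_succ_eq_word (m : ℕ) :
    hc (m + 1) = hc m + rep₁ m * ht m + rep₂ m * hh m := by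
  rw [hc_succ, quot, rep₁]; ring

theorem hc_pos (m : ℕ) : 0 < hc m := by
  induction m with
  | zero => simp [hc_zero]
  | succ m ih => rw [hc_succ]; omega

theorem hc_le_hh (m : ℕ) : hc m ≤ hh m := by
  cases m with
  | zero => simp [hc_zero, hh_zero]
  | succ m => rw [hh_succ]; omega

theorem hh_pos (m : ℕ) : 0 < hh m := (hc_pos m).trans_le (hc_le_hh m)

theorem ht_pos (m : ℕ) : 0 < ht m := by
  induction m with
  | zero => simp [ht_zero]
  | succ m ih => rw [ht_succ]; have := hc_pos m; omega

theorem thirtytwo_le_rep₂ (m : ℕ) : 32 ≤ rep₂ m := by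
  have h1 : 32 ≤ 2 ^ (m + 5) := by
    rw [pow_add]; have := Nat.one_le_two_pow (n := m); omega
  exact h1.trans (Nat.le_mul_of_pos_right _ (Nat.succ_pos _))

theorem hh_lt_hh_succ (m : ℕ) : hh m < hh (m + 1) := by
  rw [hh_succ]; have := hc_pos (m + 1); omega

theorem lt_hh (m : ℕ) : m < hh m := by
  induction m with
  | zero => simp [hh_zero]
  | succ m ih => have := hh_lt_hh_succ m; omega

theorem hh_le_hc_succ (m : ℕ) : hh m ≤ hc (m + 1) := by
  rw [hc_succ, quot]
  have := thirtytwo_le_rep₂ m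
  exact (Nat.le_mul_of_pos_left _ (by omega)).trans (Nat.le_add_left _ _)

/-- The recursion acts on the rows `(h, p)` and `(c, d)` by unimodular matrices, so the determinant
stays 1. -/
theorem hh_mul_hd (m : ℕ) : hh m * hd m = hc m * hp m + 1 := by
  induction m with
  | zero => simp [hh_zero, hd_zero, hp_zero]
  | succ m ih =>
    rw [hh_succ, hp_succ, hd_succ, hc_succ]
    nlinarith [ih]

theorem hh_mul_hd_succ (m : ℕ) : hh m * hd (m + 1) = hc (m + 1) * hp m + 1 := by
  rw [hd_succ, hc_succ]
  nlinarith [hh_mul_hd m]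

/-! ### The rotation number and its approximations -/

/-- The rotation number of the factor. -/
noncomputable def gam : ℝ := ⨆ m : ℕ, (hp m : ℝ) / hh m

theorem hp_div_mono : Monotone fun m : ℕ => (hp m : ℝ) / hh m := by
  refine monotone_nat_of_le_succ fun m => ?_
  have h1 : (0 : ℝ) < hh m := by exact_mod_cast hh_pos m
  have h2 : (0 : ℝ) < hh (m + 1) := by exact_mod_cast hh_pos (m + 1)
  rw [div_le_div_iff₀ h1 h2]
  have h3 : (hh m * hd (m + 1) : ℝ) = hc (m + 1) * hp m + 1 := by exact_mod_cast hh_mul_hd_succ m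
  rw [hp_succ, hh_succ]
  push_cast
  nlinarith

theorem hd_div_anti : Antitone fun m : ℕ => (hd m : ℝ) / hc m := by
  refine antitone_nat_of_succ_le fun m => ?_
  have h1 : (0 : ℝ) < hc m := by exact_mod_cast hc_pos m
  have h2 : (0 : ℝ) < hc (m + 1) := by exact_mod_cast hc_pos (m + 1)
  rw [div_le_div_iff₀ h2 h1]
  have h3 : (hh m * hd m : ℝ) = hc m * hp m + 1 := by exact_mod_cast hh_mul_hd m
  rw [hd_succ, hc_succ]
  push_cast
  have : (0 : ℝ) ≤ quot m := by positivity
  nlinarith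

theorem hp_div_le_hd_div (m n : ℕ) : (hp m : ℝ) / hh m ≤ (hd n : ℝ) / hc n := by
  have key : ∀ k, (hp k : ℝ) / hh k ≤ (hd k : ℝ) / hc k := fun k => by
    have h1 : (0 : ℝ) < hh k := by exact_mod_cast hh_pos k
    have h2 : (0 : ℝ) < hc k := by exact_mod_cast hc_pos k
    rw [div_le_div_iff₀ h1 h2]
    have h3 : (hh k * hd k : ℝ) = hc k * hp k + 1 := by exact_mod_cast hh_mul_hd k
    nlinarith
  exact (hp_div_mono (le_max_left m n)).trans ((key _).trans (hd_div_anti (le_max_right m n)))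

theorem hp_div_le_gam (m : ℕ) : (hp m : ℝ) / hh m ≤ gam :=
  le_ciSup (f := fun m : ℕ => (hp m : ℝ) / hh m)
    ⟨(hd 0 : ℝ) / hc 0, by rintro _ ⟨k, rfl⟩; exact hp_div_le_hd_div k 0⟩ m

theorem gam_le_hd_div (m : ℕ) : gam ≤ (hd m : ℝ) / hc m :=
  ciSup_le fun k => hp_div_le_hd_div k m

/-- The (positive) return displacement `hh m * gam - hp m` of the rotation by `gam`. -/
noncomputable def disp (m : ℕ) : ℝ := hh m * gam - hp m

/-- The (positive) backward return displacement `hd m - hc m * gam`. -/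
noncomputable def back (m : ℕ) : ℝ := hd m - hc m * gam

theorem disp_nonneg (m : ℕ) : 0 ≤ disp m := by
  have h1 : (0 : ℝ) < hh m := by exact_mod_cast hh_pos m
  have := hp_div_le_gam m
  rw [div_le_iff₀ h1] at this
  unfold disp; linarith

theorem back_nonneg (m : ℕ) : 0 ≤ back m := by
  have h1 : (0 : ℝ) < hc m := by exact_mod_cast hc_pos m
  have := gam_le_hd_div m
  rw [le_div_iff₀ h1] at this
  unfold back; linarith

theorem back_succ (m : ℕ) : back m - back (m + 1) = quot m * disp m := by
  unfold back disp; rw [hd_succ, hc_succ]; push_cast; ring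

theorem disp_succ (m : ℕ) : disp (m + 1) = disp m - back (m + 1) := by
  unfold back disp; rw [hh_succ, hp_succ]; push_cast; ring

theorem hh_mul_back (m : ℕ) : hh m * back m + hc m * disp m = 1 := by
  have h3 : (hh m * hd m : ℝ) = hc m * hp m + 1 := by exact_mod_cast hh_mul_hd m
  unfold back disp; linear_combination h3

theorem hh_mul_back_succ (m : ℕ) : hh m * back (m + 1) + hc (m + 1) * disp m = 1 := by
  have h3 : (hh m * hd (m + 1) : ℝ) = hc (m + 1) * hp m + 1 := by exact_mod_cast hh_mul_hd_succ m
  unfold back disp; linear_combination h3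

/-- If `disp m` vanished, nonnegativity of `disp (m + 1)` would force `back (m + 1) = 0`,
contradicting the determinant identity. -/
theorem disp_pos (m : ℕ) : 0 < disp m := by
  have h := disp_nonneg (m + 1)
  rw [disp_succ] at h
  have h1 := hh_mul_back_succ m
  have h2 := back_nonneg (m + 1)
  rcases (disp_nonneg m).lt_or_eq with h3 | h3
  · exact h3
  · rw [← h3] at h h1
    have : back (m + 1) = 0 := by linarith
    rw [this] at h1; norm_num at h1

theorem disp_le (m : ℕ) : disp m ≤ 1 / hc (m + 1) := by
  have h1 : (0 : ℝ) < hc (m + 1) := by exact_mod_cast hc_pos (m + 1)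
  rw [le_div_iff₀ h1]
  have := hh_mul_back_succ m
  have h2 := back_nonneg (m + 1)
  have h3 : (0 : ℝ) < hh m := by exact_mod_cast hh_pos m
  nlinarith

theorem back_le (m : ℕ) : back m ≤ 1 / hh m := by
  have h3 : (0 : ℝ) < hh m := by exact_mod_cast hh_pos m
  rw [le_div_iff₀ h3]
  have := hh_mul_back m
  have h1 : (0 : ℝ) < hc m := by exact_mod_cast hc_pos m
  nlinarith [disp_nonneg m]

theorem disp_lt (m : ℕ) (hm : 0 < m) : disp m < 1 / m := by
  refine (disp_le m).trans_lt ?_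
  have h2 : (0 : ℝ) < m := by exact_mod_cast hm
  apply one_div_lt_one_div_of_lt h2
  exact_mod_cast (lt_hh m).trans_le (hh_le_hc_succ m)

/-- For rational `gam` with denominator `b`, the number `b * disp b` would be an integer strictly
between 0 and 1. -/
theorem irrational_gam : Irrational gam := by
  rintro ⟨q, hq⟩
  have hden : 0 < q.den := q.den_pos
  have h1 := disp_pos q.den
  have h2 := disp_lt q.den hden
  have h0 : (0 : ℝ) < q.den := by exact_mod_cast hden
  have h3 : gam * q.den = q.num := by
    rw [← hq]; exact_mod_cast Rat.mul_den_eq_num q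
  have h4 : disp q.den * q.den = ((hh q.den * q.num - hp q.den * q.den : ℤ) : ℝ) := by
    push_cast
    rw [← h3, disp]; ring
  rw [lt_div_iff₀ h0, h4] at h2
  have h5 : 0 < disp q.den * q.den := mul_pos h1 h0
  rw [h4] at h5
  have h6 : (hh q.den * q.num - hp q.den * q.den : ℤ) < 1 := by exact_mod_cast h2
  have h7 : 0 < (hh q.den * q.num - hp q.den * q.den : ℤ) := by exact_mod_cast h5
  omega

/-- Multiples of `gam` by integers smaller than `hh m` are far from the integers. -/
theorem sep_gam (m : ℕ) (N P : ℤ) (hN : N ≠ 0) (hN' : |N| < hh m) :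
    1 / (hh m : ℝ) - disp m ≤ |N * gam - P| := by
  have hpos : (0 : ℝ) < hh m := by exact_mod_cast hh_pos m
  set Z : ℤ := N * hp m - P * hh m with hZ
  -- `hp m / hh m` is in lowest terms, so `hh m` would divide the nonzero `N` of smaller absolute
  -- value.
  have hZ0 : Z ≠ 0 := by
    intro h0
    have hcop : IsCoprime (hh m : ℤ) (hp m : ℤ) :=
      ⟨hd m, -(hc m), by have := hh_mul_hd m; zify at this; linarith⟩
    have hdvd : (hh m : ℤ) ∣ N * hp m := ⟨P, by linarith⟩
    have := hcop.dvd_of_dvd_mul_right hdvd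
    have := Int.le_of_dvd (abs_pos.2 hN) ((dvd_abs _ _).2 this)
    omega
  have hZ1 : (1 : ℝ) ≤ |(Z : ℝ)| := by exact_mod_cast Int.one_le_abs hZ0
  have e1 : N * gam - P = (Z + N * disp m) / hh m := by
    rw [hZ, disp]; field_simp; push_cast; ring
  have hN1 : |(N : ℝ)| ≤ hh m := by exact_mod_cast hN'.le
  have h2 : |(N : ℝ) * disp m| ≤ hh m * disp m := by
    rw [abs_mul, abs_of_nonneg (disp_nonneg m)]
    exact mul_le_mul_of_nonneg_right hN1 (disp_nonneg m)
  have h3 : |(Z : ℝ)| - |(N : ℝ) * disp m| ≤ |Z + N * disp m| := by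
    have := abs_sub_abs_le_abs_sub (Z : ℝ) (-(N * disp m))
    rwa [abs_neg, sub_neg_eq_add] at this
  rw [e1, abs_div, abs_of_pos hpos, le_div_iff₀ hpos, sub_mul, one_div_mul_cancel hpos.ne']
  linarith

/-! ### Digit sequences -/

/-- Sequences of digits: the `i`th digit is an integer between `1` and `rep₂ i - 1`. -/
abbrev Digits : Type := ∀ i : ℕ, Fin (rep₂ i - 1)

/-- The value of the `i`th digit. -/
def Digits.dig (j : Digits) (i : ℕ) : ℕ := (j i).val + 1

theorem Digits.one_le_dig (j : Digits) (i : ℕ) : 1 ≤ j.dig i := Nat.le_add_left _ _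

theorem Digits.dig_lt (j : Digits) (i : ℕ) : j.dig i + 1 ≤ rep₂ i := by
  have := (j i).isLt
  unfold Digits.dig; omega

theorem Digits.ext_dig {j j' : Digits} (h : ∀ i, j.dig i = j'.dig i) : j = j' := by
  funext i
  have := h i
  unfold Digits.dig at this
  exact Fin.ext (by omega)

/-- `e` is a weight dominated, after multiplication by `rep₂`, by the decrements of `G`. -/
structure DigitWeight (e G : ℕ → ℝ) : Prop where
  pos : ∀ i, 0 < e i
  nonneg : ∀ i, 0 ≤ G i
  le : ∀ i, rep₂ i * e i ≤ G i - G (i + 1)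

/-- The tail `∑_{i ≥ m} j_i e_i`. -/
noncomputable def tail (e : ℕ → ℝ) (j : Digits) (m : ℕ) : ℝ :=
  ∑' i, (j.dig (m + i) : ℝ) * e (m + i)

namespace DigitWeight

variable {e G : ℕ → ℝ} (w : DigitWeight e G)
include w

/-- The bound telescopes. It is used for the interval (`lam`, `kap`) and for the circle (`disp`,
`back`). -/
theorem sum_le (m n : ℕ) : ∑ i ∈ Finset.range n, (rep₂ (m + i) : ℝ) * e (m + i) ≤ G m := by
  have : ∑ i ∈ Finset.range n, (rep₂ (m + i) : ℝ) * e (m + i) ≤ G m - G (m + n) := by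
    induction n with
    | zero => simp
    | succ n ih =>
      rw [Finset.sum_range_succ]
      have := w.le (m + n)
      rw [← add_assoc]; linarith
  linarith [w.nonneg (m + n)]

theorem summable_rep (m : ℕ) : Summable fun i => (rep₂ (m + i) : ℝ) * e (m + i) :=
  summable_of_sum_range_le (fun _ => mul_nonneg (Nat.cast_nonneg _) (w.pos _).le) (w.sum_le m)

theorem tsum_rep_le (m : ℕ) : ∑' i, (rep₂ (m + i) : ℝ) * e (m + i) ≤ G m :=
  Real.tsum_le_of_sum_range_le (fun _ => mul_nonneg (Nat.cast_nonneg _) (w.pos _).le) (w.sum_le m)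

theorem dig_le (j : Digits) (i : ℕ) : (j.dig i : ℝ) * e i + e i ≤ rep₂ i * e i := by
  have h : (j.dig i : ℝ) + 1 ≤ rep₂ i := by exact_mod_cast j.dig_lt i
  nlinarith [w.pos i]

theorem summable_self (m : ℕ) : Summable fun i => e (m + i) := by
  refine (w.summable_rep m).of_nonneg_of_le (fun _ => (w.pos _).le) fun i => ?_
  have h : (32 : ℝ) ≤ rep₂ (m + i) := by exact_mod_cast thirtytwo_le_rep₂ (m + i)
  nlinarith [w.pos (m + i)]

theorem summable_dig (j : Digits) (m : ℕ) :
    Summable fun i => (j.dig (m + i) : ℝ) * e (m + i) := by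
  refine (w.summable_rep m).of_nonneg_of_le
    (fun _ => mul_nonneg (Nat.cast_nonneg _) (w.pos _).le) fun i => ?_
  linarith [w.dig_le j (m + i), w.pos (m + i)]

theorem tail_eq (j : Digits) (m : ℕ) : tail e j m = j.dig m * e m + tail e j (m + 1) := by
  unfold tail
  rw [(w.summable_dig j m).tsum_eq_zero_add]
  simp only [add_zero]
  congr 2
  funext i
  rw [show m + (i + 1) = m + 1 + i by ring]

theorem le_tsum_self (m : ℕ) : e m ≤ ∑' i, e (m + i) := by
  simpa using (w.summable_self m).le_tsum 0 (fun _ _ => (w.pos _).le)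

theorem tsum_self_le_tail (j : Digits) (m : ℕ) : ∑' i, e (m + i) ≤ tail e j m := by
  refine (w.summable_self m).tsum_le_tsum (fun i => ?_) (w.summable_dig j m)
  have : (1 : ℝ) ≤ j.dig (m + i) := by exact_mod_cast j.one_le_dig (m + i)
  nlinarith [w.pos (m + i)]

theorem tail_add_tsum_le (j : Digits) (m : ℕ) : tail e j m + ∑' i, e (m + i) ≤ G m := by
  unfold tail
  rw [← (w.summable_dig j m).tsum_add (w.summable_self m)]
  exact (((w.summable_dig j m).add (w.summable_self m)).tsum_le_tsum
    (fun i => w.dig_le j (m + i)) (w.summable_rep m)).trans (w.tsum_rep_le m)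

theorem le_tail (j : Digits) (m : ℕ) : e m ≤ tail e j m :=
  (w.le_tsum_self m).trans (w.tsum_self_le_tail j m)

theorem tail_pos (j : Digits) (m : ℕ) : 0 < tail e j m := (w.pos m).trans_le (w.le_tail j m)

theorem tail_add_le (j : Digits) (m : ℕ) : tail e j m + e m ≤ G m := by
  linarith [w.tail_add_tsum_le j m, w.le_tsum_self m]

/-- Excluding the extreme digits leaves a margin `e m` at each end. On the circle this margin is
what beats the separation in `sep_gam`. -/
theorem abs_tail_sub_le (j j' : Digits) (m : ℕ) : |tail e j m - tail e j' m| ≤ G m - 2 * e m := by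
  rw [abs_le]
  constructor <;>
  linarith [w.tail_add_le j m, w.tail_add_le j' m, w.le_tail j m, w.le_tail j' m]

theorem tail_zero_eq (j : Digits) (m : ℕ) :
    tail e j 0 = ∑ i ∈ Finset.range m, (j.dig i : ℝ) * e i + tail e j m := by
  induction m with
  | zero => simp
  | succ m ih => rw [ih, Finset.sum_range_succ, w.tail_eq j m]; ring

theorem continuous_tail (m : ℕ) : Continuous fun j : Digits => tail e j m := by
  unfold tail
  refine continuous_tsum (fun i => ?_) (w.summable_rep m) fun i j => ?_
  · refine Continuous.mul ?_ continuous_const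
    exact (continuous_of_discreteTopology
      (f := fun a : Fin (rep₂ (m + i) - 1) => ((a.val + 1 : ℕ) : ℝ))).comp (continuous_apply (m + i))
  · rw [Real.norm_of_nonneg (mul_nonneg (Nat.cast_nonneg _) (w.pos _).le)]
    linarith [w.dig_le j (m + i), w.pos (m + i)]

end DigitWeight

theorem digitWeight_disp : DigitWeight disp back where
  pos := disp_pos
  nonneg := back_nonneg
  le i := by
    rw [back_succ, quot]; push_cast
    have h1 : (0 : ℝ) ≤ (evenInd i : ℝ) * ht i := by positivity
    nlinarith [disp_pos i]

/-- The time after which the point with digits `j` enters the `m`th renormalisation interval. -/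
def entry (j : Digits) (m : ℕ) : ℕ := ∑ i ∈ Finset.range m, j.dig i * hh i

theorem entry_succ (j : Digits) (m : ℕ) : entry j (m + 1) = entry j m + j.dig m * hh m :=
  Finset.sum_range_succ _ _

/-- Each digit is at most `quot m - 1`, so every level leaves at least one spare step. The
accumulated room `m` absorbs any fixed shift of the orbit. -/
theorem entry_add_le (j : Digits) (m : ℕ) : entry j m + m + 1 ≤ hc m := by
  induction m with
  | zero => simp [entry, hc_zero]
  | succ m ih =>
    rw [entry_succ, hc_succ]
    have h1 : j.dig m + 1 ≤ quot m := (j.dig_lt m).trans (Nat.le_add_right _ _)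
    have h2 := hh_pos m
    nlinarith [Nat.mul_le_mul_right (hh m) h1]

theorem entry_add_lt (j : Digits) (m : ℕ) : entry j m + m < hh m := by
  have := entry_add_le j m
  have := hc_le_hh m
  omega

/-- The number of prefixes stays comparable to `hh m`: the factors `2 ^ (m + 5)` and `ht m + 1` in
`rep₂ m` make the relative loss at level `m` of order `2 ^ (-m)`, and the decreasing factor `1 / 2 +
1 / 2 ^ (m + 1)` pays for it. -/
theorem prod_rep₂_ge (m : ℕ) :
    (hh m : ℝ) * (1 / 2 + 1 / 2 ^ (m + 1)) ≤ ∏ i ∈ Finset.range m, ((rep₂ i : ℝ) - 1) := by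
  induction m with
  | zero => norm_num [hh_zero]
  | succ m ih =>
    rw [Finset.prod_range_succ]
    have h32 : (32 : ℝ) ≤ rep₂ m := by exact_mod_cast thirtytwo_le_rep₂ m
    refine le_trans ?_ (mul_le_mul_of_nonneg_right ih (by linarith))
    have hq : (quot m : ℝ) ≤ rep₂ m + ht m := by
      have : quot m ≤ rep₂ m + ht m := by
        unfold quot evenInd
        split_ifs <;> omega
      exact_mod_cast this
    have hb : (hh (m + 1) : ℝ) ≤ hh m * (rep₂ m + ht m + 2) := by
      rw [hh_succ, hc_succ]; push_cast
      have : (hc m : ℝ) ≤ hh m := by exact_mod_cast hc_le_hh m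
      nlinarith [mul_le_mul_of_nonneg_right hq (Nat.cast_nonneg (α := ℝ) (hh m))]
    have hr : (rep₂ m : ℝ) = 32 * 2 ^ m * (ht m + 1) := by
      unfold rep₂; push_cast; ring
    have hx : (1 : ℝ) ≤ 2 ^ m := one_le_pow₀ (by norm_num)
    have ht1 : (1 : ℝ) ≤ ht m := by exact_mod_cast ht_pos m
    set x : ℝ := 2 ^ m with hxdef
    have e1 : (2 : ℝ) ^ (m + 1) = 2 * x := by rw [pow_succ]; ring
    have e2 : (2 : ℝ) ^ (m + 1 + 1) = 4 * x := by rw [pow_succ, pow_succ]; ring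
    rw [e1, e2]
    have hx0 : 0 < x := by linarith
    have key : (rep₂ m + ht m + 2 : ℝ) * (1 / 2 + 1 / (4 * x))
        ≤ (1 / 2 + 1 / (2 * x)) * ((rep₂ m : ℝ) - 1) := by
      have : (1 / 2 + 1 / (2 * x)) * ((rep₂ m : ℝ) - 1)
          - (rep₂ m + ht m + 2 : ℝ) * (1 / 2 + 1 / (4 * x))
          = ((rep₂ m : ℝ) - (ht m + 4) - 2 * x * (ht m + 3)) / (4 * x) := by
        field_simp; ring
      have h0 : 0 ≤ ((rep₂ m : ℝ) - (ht m + 4) - 2 * x * (ht m + 3)) / (4 * x) := by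
        apply div_nonneg _ (by linarith)
        rw [hr]; nlinarith [mul_le_mul hx ht1 (by norm_num) hx0.le]
      linarith
    have hh0 : (0 : ℝ) ≤ hh m := Nat.cast_nonneg _
    calc (hh (m + 1) : ℝ) * (1 / 2 + 1 / (4 * x))
        ≤ hh m * (rep₂ m + ht m + 2) * (1 / 2 + 1 / (4 * x)) :=
          mul_le_mul_of_nonneg_right hb (by positivity)
      _ = hh m * ((rep₂ m + ht m + 2 : ℝ) * (1 / 2 + 1 / (4 * x))) := by ring
      _ ≤ hh m * ((1 / 2 + 1 / (2 * x)) * ((rep₂ m : ℝ) - 1)) :=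
          mul_le_mul_of_nonneg_left key hh0
      _ = _ := by ring

/-! ### Infinitely renormalisable widths -/

/-- The recursion determines each term from the later ones, so start from `1, 0, 0, …` and prepend
terms; `k n ≥ 1` keeps the sequence decreasing. -/
theorem exists_finite_widths (N : ℕ) : ∀ k : ℕ → ℕ, (∀ n, 1 ≤ k n) →
    ∃ l : ℕ → ℝ, Antitone l ∧ (∀ n, 0 ≤ l n) ∧ 0 < l 0 ∧
      ∀ n < N, l n = k n * l (n + 1) + l (n + 2) - l (n + 3) := by
  induction N with
  | zero =>
    intro k _
    refine ⟨fun n => if n = 0 then 1 else 0, antitone_nat_of_succ_le fun n => ?_, fun n => ?_,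
      by simp, by simp⟩
    · by_cases h : n = 0 <;> simp [h]
    · by_cases h : n = 0 <;> simp [h]
  | succ N ih =>
    intro k hk
    obtain ⟨l, hl, h0, hpos, hrec⟩ := ih (fun n => k (n + 1)) (fun n => hk _)
    have hk0 : (1 : ℝ) ≤ k 0 := by exact_mod_cast hk 0
    have h12 : l 2 ≤ l 1 := hl (by norm_num)
    have hle : l 0 ≤ k 0 * l 0 + l 1 - l 2 := by nlinarith
    refine ⟨fun n => Nat.casesOn n (k 0 * l 0 + l 1 - l 2) l, antitone_nat_of_succ_le fun n => ?_,
      fun n => ?_, by simpa using hpos.trans_le hle, fun n hn => ?_⟩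
    · cases n with
      | zero => exact hle
      | succ n => exact hl (Nat.le_succ n)
    · cases n with
      | zero => exact hpos.le.trans hle
      | succ n => exact h0 n
    · cases n with
      | zero => rfl
      | succ n => exact hrec n (by omega)

/-- After normalising `l 0 = 1`, solutions of the first `N` equations form nested nonempty compact
sets in a product of unit intervals. -/
theorem exists_widths (k : ℕ → ℕ) (hk : ∀ n, 1 ≤ k n) :
    ∃ l : ℕ → ℝ, Antitone l ∧ (∀ n, 0 < l n) ∧ l 0 = 1 ∧
      ∀ n, l n = k n * l (n + 1) + l (n + 2) - l (n + 3) := by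
  let S : ℕ → Set (ℕ → ℝ) := fun N => Set.pi Set.univ (fun _ => Set.Icc (0 : ℝ) 1) ∩
    {l | (∀ n, l (n + 1) ≤ l n) ∧ l 0 = 1 ∧
      ∀ n < N, l n = k n * l (n + 1) + l (n + 2) - l (n + 3)}
  have hcont : ∀ n, Continuous fun l : ℕ → ℝ => l n := fun n => continuous_apply n
  have hcl : ∀ N, IsClosed {l : ℕ → ℝ | (∀ n, l (n + 1) ≤ l n) ∧ l 0 = 1 ∧
      ∀ n < N, l n = k n * l (n + 1) + l (n + 2) - l (n + 3)} := by
    intro N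
    simp only [Set.ofPred_and, Set.ofPred_forall]
    refine (isClosed_iInter fun n => isClosed_le (hcont _) (hcont _)).inter
      ((isClosed_eq (hcont _) continuous_const).inter
        (isClosed_iInter fun n => isClosed_iInter fun _ => isClosed_eq (hcont _) ?_))
    exact ((continuous_const.mul (hcont _)).add (hcont _)).sub (hcont _)
  have hcpt : ∀ N, IsCompact (S N) := fun N =>
    (isCompact_univ_pi fun _ => isCompact_Icc).inter_right (hcl N)
  have hne : ∀ N, (S N).Nonempty := by
    intro N
    obtain ⟨l, hl, h0, hpos, hrec⟩ := exists_finite_widths N k hk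
    refine ⟨fun n => l n / l 0, fun n _ => ⟨div_nonneg (h0 n) hpos.le, ?_⟩, fun n => ?_, ?_,
      fun n hn => ?_⟩
    · exact (div_le_one hpos).2 (hl (Nat.zero_le n))
    · exact div_le_div_of_nonneg_right (hl (Nat.le_succ n)) hpos.le
    · exact div_self hpos.ne'
    · simp only
      rw [hrec n hn]; ring
  obtain ⟨l, hl⟩ := IsCompact.nonempty_iInter_of_sequence_nonempty_isCompact_isClosed S
    (fun N l h => ⟨h.1, h.2.1, h.2.2.1, fun n hn => h.2.2.2 n (hn.trans (Nat.lt_succ_self N))⟩)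
    hne (hcpt 0) (fun N => (hcpt N).isClosed)
  rw [Set.mem_iInter] at hl
  have hanti : Antitone l := antitone_nat_of_succ_le (hl 0).2.1
  have hrec : ∀ n, l n = k n * l (n + 1) + l (n + 2) - l (n + 3) :=
    fun n => (hl (n + 1)).2.2.2 n (Nat.lt_succ_self n)
  have hnn : ∀ n, 0 ≤ l n := fun n => ((hl 0).1 n trivial).1
  refine ⟨l, hanti, fun n => ?_, (hl 0).2.2.1, hrec⟩
  by_contra hcon
  -- A zero term kills all later ones by monotonicity, and then the recursion carries zero back to
  -- `l 0 = 1`.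
  have key : ∀ n, l n = 0 → False := by
    intro n
    induction n with
    | zero => intro h; rw [(hl 0).2.2.1] at h; norm_num at h
    | succ n ih =>
      intro h
      have h2 : l (n + 2) = 0 := le_antisymm (h ▸ hanti (Nat.le_succ _)) (hnn _)
      have h3 : l (n + 3) = 0 := le_antisymm (h2 ▸ hanti (Nat.le_succ _)) (hnn _)
      exact ih (by rw [hrec n, h, h2, h3]; ring)
  exact key n (le_antisymm (not_lt.1 hcon) (hnn n))

/-- Widths of the renormalisation intervals: the `m`th map acts on an interval of length `lam m`
with first branch translating by `kap m`, second branch by `lam (m + 1)`. -/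
structure Widths where
  lam : ℕ → ℝ
  kap : ℕ → ℝ
  lam_zero : lam 0 = 1
  lam_pos : ∀ m, 0 < lam m
  kap_lt_lam : ∀ m, kap m < lam m
  lam_lt_kap : ∀ m, lam (m + 1) < kap m
  lam_eq : ∀ m, lam m = (rep₁ m + 1) * kap m + lam (m + 1) - kap (m + 1)
  kap_eq : ∀ m, kap m = (rep₂ m + 1) * lam (m + 1) + kap (m + 1) - lam (m + 2)

theorem nonempty_widths : Nonempty Widths := by
  -- The sequence interleaves the widths: even terms are `lam`, odd terms are `kap`.
  obtain ⟨l, hanti, hpos, h0, hrec⟩ := exists_widths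
    (fun n => if Even n then rep₁ (n / 2) + 1 else rep₂ (n / 2) + 1)
    (fun n => by split_ifs <;> omega)
  have he : ∀ m, l (2 * m) = (rep₁ m + 1) * l (2 * m + 1) + l (2 * m + 2) - l (2 * m + 3) := by
    intro m
    have := hrec (2 * m)
    rw [if_pos (even_two_mul m), Nat.mul_div_cancel_left m two_pos] at this
    push_cast at this; exact this
  have ho : ∀ m, l (2 * m + 1) =
      (rep₂ m + 1) * l (2 * m + 2) + l (2 * m + 3) - l (2 * m + 4) := by
    intro m
    have := hrec (2 * m + 1)
    rw [if_neg (Nat.not_even_bit1 m), show (2 * m + 1) / 2 = m by omega] at this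
    push_cast at this; exact this
  have holt : ∀ m, l (2 * m + 2) < l (2 * m + 1) := by
    intro m
    have h1 := ho m
    have h2 : l (2 * m + 4) ≤ l (2 * m + 3) := hanti (by omega)
    have h3 : (32 : ℝ) ≤ rep₂ m := by exact_mod_cast thirtytwo_le_rep₂ m
    nlinarith [hpos (2 * m + 2)]
  have helt : ∀ m, l (2 * m + 1) < l (2 * m) := by
    -- Where `rep₁ m = 0` the difference `lam m - kap m` equals that of the next level, so
    -- strictness must come from the even levels, where `rep₁ m ≥ 1`.
    have hev : ∀ m, Even m → l (2 * m + 1) < l (2 * m) := by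
      intro m hm
      have h1 := he m
      have h2 : l (2 * m + 3) ≤ l (2 * m + 2) := hanti (by omega)
      have h3 : (1 : ℝ) ≤ rep₁ m := by
        have : 1 ≤ rep₁ m := by simp [rep₁, evenInd, hm, Nat.one_le_iff_ne_zero, (hh_pos m).ne']
        exact_mod_cast this
      nlinarith [hpos (2 * m + 1)]
    intro m
    by_cases hm : Even m
    · exact hev m hm
    · have h1 := he m
      have h2 := hev (m + 1) (by rw [Nat.even_add_one]; exact hm)
      have h3 : (0 : ℝ) ≤ rep₁ m * l (2 * m + 1) := mul_nonneg (Nat.cast_nonneg _) (hpos _).le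
      rw [show 2 * (m + 1) + 1 = 2 * m + 3 by ring, show 2 * (m + 1) = 2 * m + 2 by ring] at h2
      linarith
  exact ⟨⟨fun m => l (2 * m), fun m => l (2 * m + 1), h0, fun m => hpos _, helt, holt, he, ho⟩⟩

namespace Widths

variable (w : Widths)

theorem kap_pos (m : ℕ) : 0 < w.kap m := (w.lam_pos _).trans (w.lam_lt_kap m)

theorem lam_succ_lt (m : ℕ) : w.lam (m + 1) < w.lam m := (w.lam_lt_kap m).trans (w.kap_lt_lam m)

theorem lam_le_one (m : ℕ) : w.lam m ≤ 1 :=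
  w.lam_zero ▸ (antitone_nat_of_succ_le fun m => (w.lam_succ_lt m).le) (Nat.zero_le m)

theorem digitWeight : DigitWeight (fun i => w.lam (i + 1)) w.kap where
  pos i := w.lam_pos _
  nonneg i := (w.kap_pos i).le
  le i := by
    have := w.kap_eq i
    have := w.lam_succ_lt (i + 1)
    linarith

theorem two_mul_lam_succ_le (m : ℕ) : 2 * w.lam (m + 1) ≤ w.kap m := by
  have h1 := w.kap_eq m
  have h2 := w.lam_lt_kap (m + 1)
  have h3 : (32 : ℝ) ≤ rep₂ m := by exact_mod_cast thirtytwo_le_rep₂ m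
  nlinarith [w.lam_pos (m + 1)]

theorem lam_le_pow (m : ℕ) : w.lam m ≤ (1 / 2) ^ m := by
  induction m with
  | zero => simp [w.lam_zero]
  | succ m ih =>
    rw [pow_succ]
    linarith [w.two_mul_lam_succ_le m, w.kap_lt_lam m]

/-- The parameter with the given renormalisation widths. -/
noncomputable def param : Param where
  α := w.kap 0
  β := w.lam 1
  β_pos := w.lam_pos 1
  β_lt_α := w.lam_lt_kap 0
  α_lt_one := w.lam_zero ▸ w.kap_lt_lam 0

end Widths

/-! ### Renormalisation -/

/-- On `A`, the iterate `T^[n]` is the translation by `δ`, the earlier iterates are translations and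
avoid `J` at positive times, and Birkhoff sums of `f` of length `n` are within `e` of `n * a`. -/
structure Trans (T : I → I) (f : I → ℝ) (a : ℝ) (J A : Set ℝ) (n : ℕ) (δ e : ℝ) : Prop where
  land : ∀ x : I, (x : ℝ) ∈ A → (T^[n] x : ℝ) = x + δ
  iso : ∀ q < n, ∃ ε : ℝ, ∀ x : I, (x : ℝ) ∈ A → (T^[q] x : ℝ) = x + ε
  noret : ∀ q, 0 < q → q < n → ∀ x : I, (x : ℝ) ∈ A → (T^[q] x : ℝ) ∉ J
  err : ∀ x : I, (x : ℝ) ∈ A → |∑ q ∈ Finset.range n, f (T^[q] x) - n * a| ≤ e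

namespace Trans

variable {T : I → I} {f : I → ℝ} {a : ℝ} {J A B : Set ℝ} {n n' : ℕ} {δ δ' e e' : ℝ}

theorem mono (h : Trans T f a J B n δ e) (hAB : A ⊆ B) : Trans T f a J A n δ e where
  land x hx := h.land x (hAB hx)
  iso q hq := (h.iso q hq).imp fun _ hε x hx => hε x (hAB hx)
  noret q h0 hq x hx := h.noret q h0 hq x (hAB hx)
  err x hx := h.err x (hAB hx)

theorem congr (h : Trans T f a J A n δ e) (hn : n = n') (hδ : δ = δ') (he : e = e') :
    Trans T f a J A n' δ' e' := by subst hn hδ he; exact h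

theorem zero (T : I → I) (f : I → ℝ) (a : ℝ) (J A : Set ℝ) : Trans T f a J A 0 0 0 where
  land x _ := by simp
  iso q hq := absurd hq (Nat.not_lt_zero q)
  noret q _ hq := absurd hq (Nat.not_lt_zero q)
  err x _ := by simp

theorem concat (h : Trans T f a J A n δ e) (h' : Trans T f a J B n' δ' e')
    (hAB : ∀ x ∈ A, x + δ ∈ B) (hJ : 0 < n → ∀ x ∈ A, x + δ ∉ J) :
    Trans T f a J A (n + n') (δ + δ') (e + e') where
  land x hx := by
    have hB : (T^[n] x : ℝ) ∈ B := by rw [h.land x hx]; exact hAB x hx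
    rw [add_comm n, Function.iterate_add_apply, h'.land _ hB, h.land x hx, add_assoc]
  iso q hq := by
    by_cases hqn : q < n
    · exact h.iso q hqn
    · obtain ⟨r, rfl⟩ := Nat.exists_eq_add_of_le (not_lt.1 hqn)
      obtain ⟨ε, hε⟩ := h'.iso r (by omega)
      refine ⟨δ + ε, fun x hx => ?_⟩
      have hB : (T^[n] x : ℝ) ∈ B := by rw [h.land x hx]; exact hAB x hx
      rw [add_comm n, Function.iterate_add_apply, hε _ hB, h.land x hx, add_assoc]
  noret q h0 hq x hx := by
    by_cases hqn : q < n
    · exact h.noret q h0 hqn x hx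
    · obtain ⟨r, rfl⟩ := Nat.exists_eq_add_of_le (not_lt.1 hqn)
      have hB : (T^[n] x : ℝ) ∈ B := by rw [h.land x hx]; exact hAB x hx
      rw [add_comm n, Function.iterate_add_apply]
      rcases Nat.eq_zero_or_pos r with rfl | hr
      · simp only [Function.iterate_zero, id_eq]
        rw [h.land x hx]; exact hJ (by omega) x hx
      · exact h'.noret r hr (by omega) _ hB
  err x hx := by
    have hB : (T^[n] x : ℝ) ∈ B := by rw [h.land x hx]; exact hAB x hx
    have e1 : ∑ q ∈ Finset.range (n + n'), f (T^[q] x) - ((n + n' : ℕ) : ℝ) * a =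
        (∑ q ∈ Finset.range n, f (T^[q] x) - n * a) +
        (∑ q ∈ Finset.range n', f (T^[q] (T^[n] x)) - n' * a) := by
      rw [Finset.sum_range_add]
      simp only [← Function.iterate_add_apply, add_comm n]
      push_cast; ring
    rw [e1]
    exact (abs_add_le _ _).trans (add_le_add (h.err x hx) (h'.err _ hB))

theorem iter (h : Trans T f a J B n δ e) (k : ℕ) (hB : ∀ i < k, ∀ x ∈ A, x + i * δ ∈ B)
    (hJ : ∀ i < k, ∀ x ∈ A, x + i * δ ∉ J) : Trans T f a J A (k * n) (k * δ) (k * e) := by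
  induction k with
  | zero => exact (zero T f a J A).congr (by simp) (by simp) (by simp)
  | succ k ih =>
    refine ((ih (fun i hi => hB i (by omega)) fun i hi => hJ i (by omega)).concat h
      (hB k (by omega)) fun _ => hJ k (by omega)).congr ?_ ?_ ?_
    · ring
    · push_cast; ring
    · push_cast; ring

/-- Repeating an upward translation until the interval `[·, b)` is left. -/
theorem walk {b c : ℝ} (h : Trans T f a J (Set.Ico c b) n δ e) (hδ : 0 < δ) (N : ℕ) :
    ∀ x : I, c ≤ x → b - x ≤ N * δ → ∃ q ≤ N * n, b ≤ (T^[q] x : ℝ) := by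
  induction N with
  | zero => intro x _ hx; exact ⟨0, by simp, by simpa using hx⟩
  | succ N ih =>
    intro x hc hx
    by_cases hb : b ≤ x
    · exact ⟨0, by simp, by simpa using hb⟩
    · have hl := h.land x ⟨hc, not_le.1 hb⟩
      push_cast at hx
      obtain ⟨q, hq, hq'⟩ := ih (T^[n] x) (by linarith) (by rw [hl]; linarith)
      refine ⟨q + n, by rw [add_mul, one_mul]; omega, ?_⟩
      rwa [Function.iterate_add_apply]

end Trans

namespace Widths

variable (w : Widths)

/-- The interval translation mapping with the given renormalisation widths. -/
noncomputable abbrev T : I → I := w.param.map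

/-- The branches of the `m`th renormalised map. -/
structure Level (f : I → ℝ) (a : ℝ) (J : Set ℝ) (m : ℕ) (e₁ e₂ e₃ : ℝ) : Prop where
  one : Trans w.T f a J (Set.Ico (1 - w.lam m) (1 - w.kap m)) (ht m) (w.kap m) e₁
  two : Trans w.T f a J (Set.Ico (1 - w.kap m) (1 - w.lam (m + 1))) (hh m) (w.lam (m + 1)) e₂
  three : Trans w.T f a J (Set.Ico (1 - w.lam (m + 1)) 1) (hc m) (w.lam (m + 1) - w.lam m) e₃

variable {w}

/-- The width equations read as displacements: the third branch followed by `rep₁ m` steps `kap m`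
moves by `kap (m + 1) - kap m`; by `kap_eq'`, a further `rep₂ m` steps `lam (m + 1)` give the third
displacement of level `m + 1`. -/
theorem lam_eq' (m : ℕ) :
    w.lam (m + 1) - w.lam m = w.kap (m + 1) - w.kap m - rep₁ m * w.kap m := by
  have := w.lam_eq m; linarith

theorem kap_eq' (m : ℕ) : w.kap (m + 1) - w.kap m =
    w.lam (m + 2) - w.lam (m + 1) - rep₂ m * w.lam (m + 1) := by
  have := w.kap_eq m; linarith

/-- The common beginning of the words of the second and third branches of level `m + 1`. Throughout,
the orbit stays below `1 - lam (m + 1)`, hence outside `J`. -/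
theorem Level.prefix {f : I → ℝ} {a : ℝ} {J : Set ℝ} {m : ℕ} {e₁ e₂ e₃ : ℝ}
    (h : w.Level f a J m e₁ e₂ e₃) (hJ : ∀ y ∈ J, 1 - w.lam (m + 1) ≤ y) :
    Trans w.T f a J (Set.Ico (1 - w.lam (m + 1)) 1) (hc m + rep₁ m * ht m)
      (w.kap (m + 1) - w.kap m) (e₃ + rep₁ m * e₁) := by
  have k0 := w.kap_pos m
  have k1 := w.lam_lt_kap m
  have k2 := w.kap_lt_lam (m + 1)
  have k3 := w.two_mul_lam_succ_le m
  have k4 := w.kap_lt_lam m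
  have l1 := w.lam_eq' m
  have key : ∀ i < rep₁ m, ∀ y ∈ {y | y - (w.lam (m + 1) - w.lam m) ∈
      Set.Ico (1 - w.lam (m + 1)) 1}, y + i * w.kap m < 1 - w.kap m ∧ 1 - w.lam m ≤ y := by
    intro i hi y hy
    have hi' : (i : ℝ) + 1 ≤ rep₁ m := by exact_mod_cast hi
    obtain ⟨hy1, hy2⟩ := hy
    constructor
    · nlinarith
    · linarith
  refine (h.three.concat (B := {y | y - (w.lam (m + 1) - w.lam m) ∈
      Set.Ico (1 - w.lam (m + 1)) 1}) (h.one.iter (rep₁ m) (fun i hi y hy => ?_)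
      fun i hi y hy hyJ => ?_) (fun x hx => ?_) fun _ x hx hxJ => ?_).congr rfl ?_ rfl
  · obtain ⟨q1, q2⟩ := key i hi y hy
    exact ⟨by have : 0 ≤ (i : ℝ) * w.kap m := by positivity
              linarith, q1⟩
  · linarith [hJ _ hyJ, (key i hi y hy).1]
  · simpa using hx
  · have := hJ _ hxJ
    linarith [hx.2]
  · linarith

/-- Each new branch is a concatenation of old ones, and times, displacements and errors add along
it. One induction thus serves both first returns (`f = 0`) and Birkhoff sums (`J = ∅`). -/
theorem Level.succ {f : I → ℝ} {a : ℝ} {J : Set ℝ} {m : ℕ} {e₁ e₂ e₃ : ℝ}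
    (h : w.Level f a J m e₁ e₂ e₃) (hJ : ∀ y ∈ J, 1 - w.lam (m + 1) ≤ y) :
    w.Level f a J (m + 1) (e₃ + (rep₁ m + 1) * e₁) (e₃ + rep₁ m * e₁ + (rep₂ m + 1) * e₂)
      (e₃ + rep₁ m * e₁ + rep₂ m * e₂) := by
  have k0 := w.kap_pos m
  have k0' := w.lam_pos (m + 1)
  have k1 := w.lam_lt_kap m
  have k2 := w.kap_lt_lam (m + 1)
  have k2' := w.kap_pos (m + 1)
  have k3 := w.two_mul_lam_succ_le m
  have k4 := w.kap_lt_lam m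
  have k5 := w.lam_lt_kap (m + 1)
  have k6 := w.lam_pos (m + 1 + 1)
  have l1 := w.lam_eq' m
  have l2 := w.kap_eq' m
  have hP := h.prefix hJ
  have h32 : (32 : ℝ) ≤ rep₂ m := by exact_mod_cast thirtytwo_le_rep₂ m
  constructor
  · have key : ∀ i < rep₁ m + 1, ∀ y ∈ {y | y - (w.lam (m + 1) - w.lam m) ∈
        Set.Ico (1 - w.lam (m + 1)) (1 - w.kap (m + 1))},
        y + i * w.kap m < 1 - w.kap m ∧ 1 - w.lam m ≤ y := by
      intro i hi y hy
      have hi' : (i : ℝ) ≤ rep₁ m := by exact_mod_cast Nat.lt_succ_iff.1 hi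
      obtain ⟨hy1, hy2⟩ := hy
      constructor
      · nlinarith
      · linarith
    refine ((h.three.mono (Set.Ico_subset_Ico_right (by linarith))).concat
      (B := {y | y - (w.lam (m + 1) - w.lam m) ∈
      Set.Ico (1 - w.lam (m + 1)) (1 - w.kap (m + 1))})
      (h.one.iter (rep₁ m + 1) (fun i hi y hy => ?_)
      fun i hi y hy hyJ => ?_) (fun x hx => ?_) fun _ x hx hxJ => ?_).congr ?_ ?_ ?_
    · obtain ⟨q1, q2⟩ := key i hi y hy
      exact ⟨by have : 0 ≤ (i : ℝ) * w.kap m := by positivity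
                linarith, q1⟩
    · linarith [hJ _ hyJ, (key i hi y hy).1]
    · simpa using hx
    · have := hJ _ hxJ
      linarith [hx.2]
    · rw [ht_succ]
    · push_cast; linarith
    · push_cast; ring
  · have key : ∀ i < rep₂ m + 1, ∀ y ∈ {y | y - (w.kap (m + 1) - w.kap m) ∈
        Set.Ico (1 - w.kap (m + 1)) (1 - w.lam (m + 1 + 1))},
        y + i * w.lam (m + 1) < 1 - w.lam (m + 1) ∧ 1 - w.kap m ≤ y := by
      intro i hi y hy
      have hi' : (i : ℝ) ≤ rep₂ m := by exact_mod_cast Nat.lt_succ_iff.1 hi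
      obtain ⟨hy1, hy2⟩ := hy
      constructor
      · nlinarith
      · linarith
    refine ((hP.mono (Set.Ico_subset_Ico (by linarith) (by linarith))).concat
      (B := {y | y - (w.kap (m + 1) - w.kap m) ∈
      Set.Ico (1 - w.kap (m + 1)) (1 - w.lam (m + 1 + 1))})
      (h.two.iter (rep₂ m + 1) (fun i hi y hy => ?_)
      fun i hi y hy hyJ => ?_) (fun x hx => ?_) fun _ x hx hxJ => ?_).congr ?_ ?_ ?_
    · obtain ⟨q1, q2⟩ := key i hi y hy
      exact ⟨by have : 0 ≤ (i : ℝ) * w.lam (m + 1) := by positivity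
                linarith, q1⟩
    · linarith [hJ _ hyJ, (key i hi y hy).1]
    · simpa using hx
    · have := hJ _ hxJ
      nlinarith [hx.2]
    · rw [hh_succ, hc_succ_eq_word]; ring
    · push_cast; linarith
    · push_cast; ring
  · have key : ∀ i < rep₂ m, ∀ y ∈ {y | y - (w.kap (m + 1) - w.kap m) ∈
        Set.Ico (1 - w.lam (m + 1 + 1)) 1},
        y + i * w.lam (m + 1) < 1 - w.lam (m + 1) ∧ 1 - w.kap m ≤ y := by
      intro i hi y hy
      have hi' : (i : ℝ) + 1 ≤ rep₂ m := by exact_mod_cast hi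
      obtain ⟨hy1, hy2⟩ := hy
      constructor
      · nlinarith
      · linarith
    refine ((hP.mono (Set.Ico_subset_Ico_left (by linarith))).concat
      (B := {y | y - (w.kap (m + 1) - w.kap m) ∈ Set.Ico (1 - w.lam (m + 1 + 1)) 1})
      (h.two.iter (rep₂ m) (fun i hi y hy => ?_)
      fun i hi y hy hyJ => ?_) (fun x hx => ?_) fun _ x hx hxJ => ?_).congr ?_ ?_ ?_
    · obtain ⟨q1, q2⟩ := key i hi y hy
      exact ⟨by have : 0 ≤ (i : ℝ) * w.lam (m + 1) := by positivity
                linarith, q1⟩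
    · linarith [hJ _ hyJ, (key i hi y hy).1]
    · simpa using hx
    · have := hJ _ hxJ
      nlinarith [hx.2]
    · rw [hc_succ_eq_word]
    · linarith
    · rfl

variable (w)

theorem Level.mono_J {f : I → ℝ} {a : ℝ} {J J' : Set ℝ} {m : ℕ} {e₁ e₂ e₃ : ℝ}
    (h : w.Level f a J m e₁ e₂ e₃) (hJ : J' ⊆ J) : w.Level f a J' m e₁ e₂ e₃ :=
  ⟨⟨h.1.1, h.1.2, fun q h0 hq x hx hJ' => h.1.3 q h0 hq x hx (hJ hJ'), h.1.4⟩,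
   ⟨h.2.1, h.2.2, fun q h0 hq x hx hJ' => h.2.3 q h0 hq x hx (hJ hJ'), h.2.4⟩,
   ⟨h.3.1, h.3.2, fun q h0 hq x hx hJ' => h.3.3 q h0 hq x hx (hJ hJ'), h.3.4⟩⟩

theorem map_coe (x : I) : (w.T x : ℝ) =
    if (x : ℝ) < 1 - w.kap 0 then x + w.kap 0
    else if (x : ℝ) < 1 - w.lam 1 then x + w.lam 1 else x + w.lam 1 - 1 := rfl

theorem trans_one {J A : Set ℝ} {δ : ℝ} (h : ∀ x : I, (x : ℝ) ∈ A → (w.T x : ℝ) = x + δ) :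
    Trans w.T 0 0 J A 1 δ 0 where
  land := h
  iso q hq := ⟨0, fun x _ => by rw [Nat.lt_one_iff.1 hq]; simp⟩
  noret q h0 hq := absurd h0 (by omega)
  err x _ := by simp

theorem level_zero : w.Level 0 0 (Set.Ici (1 - w.lam 0)) 0 0 0 0 where
  one := (w.trans_one fun x hx => by rw [map_coe, if_pos hx.2]).congr ht_zero.symm rfl rfl
  two := (w.trans_one fun x hx => by
    rw [map_coe, if_neg (not_lt.2 hx.1), if_pos hx.2]).congr hh_zero.symm rfl rfl
  three := (w.trans_one fun x hx => by
    have h0 := w.lam_lt_kap 0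
    have h1 := hx.1
    rw [zero_add] at *
    rw [map_coe, if_neg (by linarith), if_neg (by linarith), w.lam_zero]; ring).congr
      hc_zero.symm rfl rfl

/-- The branches of the first return map to `[1 - lam m, 1)`. -/
theorem level (m : ℕ) : w.Level 0 0 (Set.Ici (1 - w.lam m)) m 0 0 0 := by
  induction m with
  | zero => exact w.level_zero
  | succ m ih =>
    have := (ih.mono_J w (J' := Set.Ici (1 - w.lam (m + 1)))
      (Set.Ici_subset_Ici.2 (by linarith [w.lam_succ_lt m]))).succ (fun y hy => hy)
    simpa using this

/-- Every point enters the renormalisation interval within a bounded time. -/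
theorem exists_entry (m : ℕ) :
    ∃ N : ℕ, ∀ x : I, ∃ q ≤ N, 1 - w.lam m ≤ (w.T^[q] x : ℝ) := by
  induction m with
  | zero => exact ⟨0, fun x => ⟨0, le_rfl, by simpa [w.lam_zero] using x.2.1⟩⟩
  | succ m ih =>
    obtain ⟨N, hN⟩ := ih
    obtain ⟨N₁, hN₁⟩ := exists_nat_ge (1 / w.kap m)
    obtain ⟨N₂, hN₂⟩ := exists_nat_ge (1 / w.lam (m + 1))
    rw [div_le_iff₀ (w.kap_pos m)] at hN₁
    rw [div_le_iff₀ (w.lam_pos _)] at hN₂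
    refine ⟨N + N₁ * ht m + N₂ * hh m, fun x => ?_⟩
    obtain ⟨q, hq, hx⟩ := hN x
    obtain ⟨q₁, hq₁, hx₁⟩ := (w.level m).one.walk (w.kap_pos m) N₁ (w.T^[q] x) hx
      (by linarith [w.kap_pos m, (w.T^[q] x).2.1])
    obtain ⟨q₂, hq₂, hx₂⟩ := (w.level m).two.walk (w.lam_pos _) N₂ _ hx₁
      (by linarith [w.lam_pos (m + 1), (w.T^[q₁] (w.T^[q] x)).2.1])
    refine ⟨q₂ + q₁ + q, by omega, ?_⟩
    rwa [Function.iterate_add_apply, Function.iterate_add_apply]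

end Widths

/-! ### Uniform convergence of Birkhoff averages -/

theorem abs_birkhoff_sub_le {T : I → I} {f : I → ℝ} {a B : ℝ} (hB : ∀ x, |f x - a| ≤ B)
    (n : ℕ) (x : I) : |∑ q ∈ Finset.range n, f (T^[q] x) - n * a| ≤ n * B := by
  have : ∑ q ∈ Finset.range n, f (T^[q] x) - n * a =
      ∑ q ∈ Finset.range n, (f (T^[q] x) - a) := by simp
  rw [this]
  refine (Finset.abs_sum_le_sum_abs _ _).trans ((Finset.sum_le_sum fun q _ => hB _).trans ?_)
  simp

theorem birkhoff_split (T : I → I) (f : I → ℝ) (a : ℝ) (r s : ℕ) (x : I) :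
    ∑ q ∈ Finset.range (r + s), f (T^[q] x) - ((r + s : ℕ) : ℝ) * a =
      (∑ q ∈ Finset.range r, f (T^[q] x) - r * a) +
      (∑ q ∈ Finset.range s, f (T^[q] (T^[r] x)) - s * a) := by
  rw [Finset.sum_range_add]
  simp only [← Function.iterate_add_apply, add_comm r]
  push_cast; ring

/-- Birkhoff sums are controlled by their values on the return blocks to a set `J` which every
orbit enters in bounded time. -/
theorem birkhoff_of_blocks {T : I → I} {f : I → ℝ} {a B ε : ℝ} {R N : ℕ} {J : Set I}
    (hB : ∀ x, |f x - a| ≤ B) (hε : 0 ≤ ε) (hN : ∀ x, ∃ q ≤ N, T^[q] x ∈ J)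
    (hR : ∀ y ∈ J, ∃ r, 0 < r ∧ r ≤ R ∧ T^[r] y ∈ J ∧
      |∑ q ∈ Finset.range r, f (T^[q] y) - r * a| ≤ ε * r) (n : ℕ) (x : I) :
    |∑ q ∈ Finset.range n, f (T^[q] x) - n * a| ≤ ε * n + (R + N) * B := by
  have hB0 : 0 ≤ B := (abs_nonneg _).trans (hB x)
  have hJ : ∀ n : ℕ, ∀ y ∈ J,
      |∑ q ∈ Finset.range n, f (T^[q] y) - n * a| ≤ ε * n + R * B := by
    intro n
    induction n using Nat.strong_induction_on with
    | _ n ih =>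
      intro y hy
      by_cases hn : n < R
      · have h1 : (n : ℝ) ≤ R := by exact_mod_cast hn.le
        have h2 : 0 ≤ ε * n := by positivity
        nlinarith [abs_birkhoff_sub_le (T := T) hB n y]
      · obtain ⟨r, h0, hr, hy', hs⟩ := hR y hy
        obtain ⟨s, rfl⟩ := Nat.exists_eq_add_of_le (hr.trans (not_lt.1 hn))
        rw [birkhoff_split]
        have := (abs_add_le _ _).trans (add_le_add hs (ih s (by omega) _ hy'))
        push_cast
        linarith
  obtain ⟨q, hq, hx⟩ := hN x
  have hqN : (q : ℝ) ≤ N := by exact_mod_cast hq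
  by_cases hn : n ≤ q
  · have h1 : (n : ℝ) ≤ N := by exact_mod_cast hn.trans hq
    have h2 : 0 ≤ ε * n := by positivity
    have h3 : 0 ≤ (R : ℝ) * B := by positivity
    nlinarith [abs_birkhoff_sub_le (T := T) hB n x]
  · obtain ⟨s, rfl⟩ := Nat.exists_eq_add_of_le (not_le.1 hn).le
    rw [birkhoff_split]
    have := (abs_add_le _ _).trans
      (add_le_add (abs_birkhoff_sub_le (T := T) hB q x) (hJ s _ hx))
    push_cast
    have h2 : 0 ≤ ε * q := by positivity
    nlinarith

theorem Trans.with_err {T : I → I} {f g : I → ℝ} {a b : ℝ} {J A : Set ℝ} {n : ℕ} {δ e e' : ℝ}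
    (h : Trans T f a J A n δ e)
    (he : ∀ x : I, (x : ℝ) ∈ A → |∑ q ∈ Finset.range n, g (T^[q] x) - n * b| ≤ e') :
    Trans T g b ∅ A n δ e' :=
  ⟨h.land, h.iso, fun _ _ _ _ _ => id, he⟩

namespace Widths

variable (w : Widths)

theorem two_nonempty (m : ℕ) :
    ∃ z : I, (z : ℝ) ∈ Set.Ico (1 - w.kap m) (1 - w.lam (m + 1)) :=
  ⟨⟨1 - w.kap m, by linarith [w.kap_lt_lam m, w.lam_le_one m], by linarith [w.kap_pos m]⟩,
    le_rfl, by linarith [w.lam_lt_kap m]⟩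

/-- The constant is the mean of `f` along one passage of the second branch. Other points of that
branch undergo the same translations, so each term changes by at most `K * lam m`; the other two
branches get only the trivial bound. -/
theorem exists_level_lipschitz {f : I → ℝ} {K : NNReal} (hf : LipschitzWith K f) {B : ℝ}
    (hB : ∀ x, |f x| ≤ B) (m : ℕ) :
    ∃ a, (∀ x, |f x - a| ≤ 2 * B) ∧
      w.Level f a ∅ m (ht m * (2 * B)) (hh m * (K * w.lam m)) (hc m * (2 * B)) := by
  obtain ⟨z, hz⟩ := w.two_nonempty m
  have hpos : (0 : ℝ) < hh m := by exact_mod_cast hh_pos m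
  set a : ℝ := (∑ q ∈ Finset.range (hh m), f (w.T^[q] z)) / hh m with ha
  have haB : |a| ≤ B := by
    rw [ha, abs_div, abs_of_pos hpos, div_le_iff₀ hpos]
    refine (Finset.abs_sum_le_sum_abs _ _).trans ((Finset.sum_le_sum fun q _ => hB _).trans ?_)
    simp [mul_comm]
  have hfa : ∀ x, |f x - a| ≤ 2 * B := fun x => by
    refine (abs_sub _ _).trans ?_
    linarith [hB x]
  have L := w.level m
  refine ⟨a, hfa, L.one.with_err fun x _ => abs_birkhoff_sub_le hfa _ x,
    L.two.with_err fun x hx => ?_, L.three.with_err fun x _ => abs_birkhoff_sub_le hfa _ x⟩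
  have e1 : ∑ q ∈ Finset.range (hh m), f (w.T^[q] x) - hh m * a =
      ∑ q ∈ Finset.range (hh m), (f (w.T^[q] x) - f (w.T^[q] z)) := by
    rw [Finset.sum_sub_distrib, ha, mul_div_cancel₀ _ hpos.ne']
  rw [e1]
  refine (Finset.abs_sum_le_sum_abs _ _).trans ?_
  have key : ∀ q ∈ Finset.range (hh m), |f (w.T^[q] x) - f (w.T^[q] z)| ≤ K * w.lam m := by
    intro q hq
    obtain ⟨ε, hε⟩ := L.two.iso q (Finset.mem_range.1 hq)
    have h1 := hf.dist_le_mul (w.T^[q] x) (w.T^[q] z)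
    rw [Real.dist_eq, Subtype.dist_eq, Real.dist_eq, hε x hx, hε z hz] at h1
    refine h1.trans (mul_le_mul_of_nonneg_left ?_ K.2)
    rw [abs_le]
    have := w.lam_pos (m + 1)
    have := w.kap_lt_lam m
    constructor <;> linarith [hx.1, hx.2, hz.1, hz.2]
  exact (Finset.sum_le_sum key).trans (by simp)

/-- The factor `ht m + 1` in `rep₂ m` serves here: `ht (m + 1)` is at most `3 * hh m * (ht m + 1)`,
even when `rep₁ m = hh m`. -/
theorem ht_succ_le (m : ℕ) : 2 ^ m * ht (m + 1) ≤ hc (m + 1) := by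
  have h1 := hc_le_hh m
  have h2 := hh_pos m
  have h3 := ht_pos m
  have h4 : rep₁ m ≤ hh m := by
    unfold rep₁ evenInd; split_ifs <;> omega
  have h5 : ht (m + 1) ≤ 3 * (hh m * (ht m + 1)) := by
    rw [ht_succ]; nlinarith [Nat.mul_le_mul_right (ht m) h4]
  calc 2 ^ m * ht (m + 1) ≤ 2 ^ m * (3 * (hh m * (ht m + 1))) := Nat.mul_le_mul_left _ h5
    _ ≤ rep₂ m * hh m := by
      unfold rep₂
      rw [pow_add]
      nlinarith [Nat.zero_le (2 ^ m * (hh m * (ht m + 1)))]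
    _ ≤ hc (m + 1) := by rw [hc_succ_eq_word]; exact Nat.le_add_left _ _

/-- Return blocks of the interval at level `m + 2` have almost equal averages, for even `m`. -/
theorem exists_average {f : I → ℝ} {K : NNReal} (hf : LipschitzWith K f) {B : ℝ}
    (hB : ∀ x, |f x| ≤ B) (m : ℕ) (hm : Even m) :
    ∃ a C : ℝ, ∀ x n, |∑ q ∈ Finset.range n, f (w.T^[q] x) - n * a| ≤
      ((K + 4 * B) * (1 / 2) ^ m) * n + C := by
  obtain ⟨a, hfa, L⟩ := w.exists_level_lipschitz hf hB m
  have hB0 : 0 ≤ B := (abs_nonneg _).trans (hB ⟨0, by norm_num, by norm_num⟩)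
  have hK0 : (0 : ℝ) ≤ K := K.2
  have L1 := L.succ (fun y hy => hy.elim)
  have L2 := L1.succ (fun y hy => hy.elim)
  -- Level `m + 1` is odd, so a word of level `m + 2` contains the badly controlled first branch of
  -- level `m + 1` at most once.
  have hodd : rep₁ (m + 1) = 0 := by
    simp [rep₁, evenInd, Nat.even_add_one, hm]
  set r : ℝ := (1 / 2) ^ m with hr
  have hr0 : 0 ≤ r := by positivity
  have hlam : w.lam m ≤ r := w.lam_le_pow m
  have htr : (ht (m + 1) : ℝ) ≤ r * hc (m + 1) := by
    have h1 : ((2 : ℝ) ^ m) * ht (m + 1) ≤ hc (m + 1) := by exact_mod_cast ht_succ_le m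
    rw [hr, one_div, inv_pow, inv_mul_eq_div, le_div_iff₀ (by positivity), mul_comm]
    exact h1
  have t1 : (ht (m + 1) : ℝ) = hc m + (rep₁ m + 1) * ht m := by
    rw [ht_succ]; push_cast; ring
  have c1 : (hc (m + 1) : ℝ) = hc m + rep₁ m * ht m + rep₂ m * hh m := by
    rw [hc_succ_eq_word]; push_cast; ring
  have h1 : (hh (m + 1) : ℝ) = hc (m + 1) + hh m := by rw [hh_succ]; push_cast; ring
  have t2 : (ht (m + 2) : ℝ) = hc (m + 1) + ht (m + 1) := by
    rw [ht_succ, hodd]; push_cast; ring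
  have c2 : (hc (m + 2) : ℝ) = hc (m + 1) + rep₂ (m + 1) * hh (m + 1) := by
    rw [hc_succ_eq_word, hodd]; push_cast; ring
  have h2 : (hh (m + 2) : ℝ) = hc (m + 2) + hh (m + 1) := by rw [hh_succ]; push_cast; ring
  have n1 : (0 : ℝ) ≤ ht m := Nat.cast_nonneg _
  have n2 : (0 : ℝ) ≤ hh m := Nat.cast_nonneg _
  have n3 : (0 : ℝ) ≤ hc m := Nat.cast_nonneg _
  have n4 : (0 : ℝ) ≤ rep₁ m := Nat.cast_nonneg _
  have n5 : (0 : ℝ) ≤ rep₂ m := Nat.cast_nonneg _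
  have n6 : (0 : ℝ) ≤ rep₂ (m + 1) := Nat.cast_nonneg _
  have n7 : (0 : ℝ) ≤ hc (m + 1) := Nat.cast_nonneg _
  have n8 : (0 : ℝ) ≤ ht (m + 1) := Nat.cast_nonneg _
  have n9 : (0 : ℝ) ≤ hh (m + 1) := Nat.cast_nonneg _
  set θ : ℝ := (K + 2 * B) * r with hθ
  have hθ0 : 0 ≤ θ := by positivity
  have hKl : K * w.lam m ≤ K * r := mul_le_mul_of_nonneg_left hlam hK0
  set E₃ : ℝ := hc m * (2 * B) + rep₁ m * (ht m * (2 * B)) + rep₂ m * (hh m * (K * w.lam m))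
    with hE₃
  -- Time spent outside the second branch of level `m` is a proportion at most `r` of the third word
  -- of level `m + 1`.
  have bS : (hc m : ℝ) + rep₁ m * ht m ≤ r * hc (m + 1) := by linarith
  have b3 : E₃ ≤ θ * hc (m + 1) := by
    have i1 : (hc m + rep₁ m * ht m) * (2 * B) ≤ r * hc (m + 1) * (2 * B) :=
      mul_le_mul_of_nonneg_right bS (by linarith)
    have i2 : (rep₂ m * hh m) * (K * w.lam m) ≤ hc (m + 1) * (K * r) := by
      apply mul_le_mul _ hKl (mul_nonneg hK0 (w.lam_pos m).le) n7
      rw [c1]; linarith [mul_nonneg n4 n1]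
    rw [hE₃, hθ]; linarith
  have b2 : hc m * (2 * B) + rep₁ m * (ht m * (2 * B)) +
      (rep₂ m + 1) * (hh m * (K * w.lam m)) ≤ θ * hh (m + 1) := by
    have i3 : hh m * (K * w.lam m) ≤ hh m * θ := by
      apply mul_le_mul_of_nonneg_left _ n2
      have := mul_nonneg hB0 hr0
      rw [hθ]; linarith
    have i4 : hc m * (2 * B) + rep₁ m * (ht m * (2 * B)) +
        (rep₂ m + 1) * (hh m * (K * w.lam m)) = E₃ + hh m * (K * w.lam m) := by rw [hE₃]; ring
    rw [h1, i4]; linarith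
  have b1 : hc m * (2 * B) + (rep₁ m + 1) * (ht m * (2 * B)) ≤ 2 * B * r * hc (m + 1) := by
    have : hc m * (2 * B) + (rep₁ m + 1) * (ht m * (2 * B)) = 2 * B * ht (m + 1) := by
      rw [t1]; ring
    rw [this, mul_assoc (2 * B)]
    exact mul_le_mul_of_nonneg_left htr (by positivity)
  have hε : (K + 4 * B) * r = θ + 2 * B * r := by rw [hθ]; ring
  have hBr : 0 ≤ 2 * B * r := by positivity
  obtain ⟨N, hN⟩ := w.exists_entry (m + 2)
  refine ⟨a, _, fun x n => birkhoff_of_blocks (J := {x : I | 1 - w.lam (m + 2) ≤ (x : ℝ)})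
    (R := ht (m + 2) + hh (m + 2) + hc (m + 2)) hfa (by rw [hε]; linarith) hN ?_ n x⟩
  intro y hy
  have p1 := ht_pos (m + 2)
  have p2 := hh_pos (m + 2)
  have p3 := hc_pos (m + 2)
  have g1 := w.kap_pos (m + 2)
  have g2 := w.lam_pos (m + 3)
  have g3 := w.lam_lt_kap (m + 2)
  have g4 := w.kap_lt_lam (m + 2)
  have hy0 : 1 - w.lam (m + 2) ≤ (y : ℝ) := hy
  by_cases hy1 : (y : ℝ) < 1 - w.kap (m + 2)
  · have hmem : (y : ℝ) ∈ Set.Ico (1 - w.lam (m + 2)) (1 - w.kap (m + 2)) := ⟨hy, hy1⟩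
    refine ⟨ht (m + 2), p1, by omega, ?_, (L2.one.err y hmem).trans ?_⟩
    · change 1 - w.lam (m + 2) ≤ _
      rw [L2.one.land y hmem]; linarith
    · rw [hε, hodd, t2]; push_cast
      nlinarith [mul_nonneg hθ0 n8, mul_nonneg hBr n8]
  by_cases hy2 : (y : ℝ) < 1 - w.lam (m + 3)
  · have hmem : (y : ℝ) ∈ Set.Ico (1 - w.kap (m + 2)) (1 - w.lam (m + 3)) := ⟨not_lt.1 hy1, hy2⟩
    refine ⟨hh (m + 2), p2, by omega, ?_, (L2.two.err y hmem).trans ?_⟩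
    · change 1 - w.lam (m + 2) ≤ _
      rw [L2.two.land y hmem]; linarith
    · have := mul_le_mul_of_nonneg_left b2 (by linarith : (0 : ℝ) ≤ rep₂ (m + 1) + 1)
      have q : θ * hh (m + 2) ≤ (θ + 2 * B * r) * hh (m + 2) :=
        mul_le_mul_of_nonneg_right (by linarith) (Nat.cast_nonneg _)
      rw [hε, hodd]
      refine le_trans ?_ q
      rw [h2, c2]; push_cast
      linarith
  · have hmem : (y : ℝ) ∈ Set.Ico (1 - w.lam (m + 3)) 1 := ⟨not_lt.1 hy2, y.2.2⟩
    refine ⟨hc (m + 2), p3, by omega, ?_, (L2.three.err y hmem).trans ?_⟩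
    · change 1 - w.lam (m + 2) ≤ _
      rw [L2.three.land y hmem]; linarith [hmem.1]
    · have := mul_le_mul_of_nonneg_left b2 n6
      have q : θ * hc (m + 2) ≤ (θ + 2 * B * r) * hc (m + 2) :=
        mul_le_mul_of_nonneg_right (by linarith) (Nat.cast_nonneg _)
      rw [hε, hodd]
      refine le_trans ?_ q
      rw [c2]; push_cast
      linarith

/-- Birkhoff averages of bounded Lipschitz functions become uniformly close to constants. -/
theorem eventually_average {f : I → ℝ} {K : NNReal} (hf : LipschitzWith K f) {B : ℝ}
    (hB : ∀ x, |f x| ≤ B) {ε : ℝ} (hε : 0 < ε) :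
    ∃ a : ℝ, ∀ᶠ n : ℕ in atTop, ∀ x,
      |(n : ℝ)⁻¹ * ∑ q ∈ Finset.range n, f (w.T^[q] x) - a| ≤ ε := by
  have hlim : Tendsto (fun m : ℕ => (K + 4 * B) * (1 / 2 : ℝ) ^ m) atTop (𝓝 0) := by
    simpa using (tendsto_pow_atTop_nhds_zero_of_lt_one
      (by norm_num : (0 : ℝ) ≤ 1 / 2) (by norm_num)).const_mul ((K : ℝ) + 4 * B)
  obtain ⟨m, hm⟩ := eventually_atTop.1 (hlim.eventually_le_const (half_pos hε))
  obtain ⟨a, C, h⟩ := w.exists_average hf hB (2 * m) (even_two_mul m)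
  refine ⟨a, ?_⟩
  have hC : Tendsto (fun n : ℕ => C / (n : ℝ)) atTop (𝓝 0) :=
    tendsto_const_div_atTop_nhds_zero_nat C
  filter_upwards [hC.eventually_le_const (half_pos hε), eventually_gt_atTop 0] with n hn hn0 x
  have hn' : (0 : ℝ) < n := by exact_mod_cast hn0
  have e1 : (n : ℝ)⁻¹ * ∑ q ∈ Finset.range n, f (w.T^[q] x) - a =
      (∑ q ∈ Finset.range n, f (w.T^[q] x) - n * a) / n := by field_simp
  rw [e1, abs_div, abs_of_pos hn', div_le_iff₀ hn']
  rw [div_le_iff₀ hn'] at hn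
  have h1 := hm (2 * m) (by omega)
  nlinarith [h x n]

end Widths

namespace Widths

variable (w : Widths)

/-! ### Infinite type -/

/-- The missed point is where the image of the third branch stops; the images of the other two begin
strictly to its right. -/
theorem first_return (m : ℕ) (u : I) (hu : 1 - w.lam m ≤ (u : ℝ)) :
    ∃ r, 0 < r ∧ 1 - w.lam m ≤ (w.T^[r] u : ℝ) ∧
      (∀ q, 0 < q → q < r → (w.T^[q] u : ℝ) < 1 - w.lam m) ∧
      (w.T^[r] u : ℝ) ≠ 1 - w.lam m + w.lam (m + 1) := by
  have g1 := w.kap_pos m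
  have g2 := w.lam_pos (m + 1)
  have g3 := w.lam_lt_kap m
  have g4 := w.kap_lt_lam m
  have L := w.level m
  by_cases hu1 : (u : ℝ) < 1 - w.kap m
  · have hmem : (u : ℝ) ∈ Set.Ico (1 - w.lam m) (1 - w.kap m) := ⟨hu, hu1⟩
    refine ⟨ht m, ht_pos m, ?_, fun q h0 hq => not_le.1 (L.one.noret q h0 hq u hmem), ?_⟩
    · rw [L.one.land u hmem]; linarith
    · rw [L.one.land u hmem]; exact (by linarith : _ < _).ne'
  by_cases hu2 : (u : ℝ) < 1 - w.lam (m + 1)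
  · have hmem : (u : ℝ) ∈ Set.Ico (1 - w.kap m) (1 - w.lam (m + 1)) := ⟨not_lt.1 hu1, hu2⟩
    refine ⟨hh m, hh_pos m, ?_, fun q h0 hq => not_le.1 (L.two.noret q h0 hq u hmem), ?_⟩
    · rw [L.two.land u hmem]; linarith
    · rw [L.two.land u hmem]; exact (by linarith [hmem.1] : _ < _).ne'
  · have hmem : (u : ℝ) ∈ Set.Ico (1 - w.lam (m + 1)) 1 := ⟨not_lt.1 hu2, u.2.2⟩
    refine ⟨hc m, hc_pos m, ?_, fun q h0 hq => not_le.1 (L.three.noret q h0 hq u hmem), ?_⟩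
    · rw [L.three.land u hmem]; linarith [hmem.1]
    · rw [L.three.land u hmem]; exact (by linarith [hmem.2] : _ < _).ne

theorem isInfiniteType : IsInfiniteType w.T := by
  rintro ⟨N, hN⟩
  have hmem : ∀ (g : I) (n : ℕ), g ∈ attractor w.T n ↔ ∀ j ≤ n, ∃ y, w.T^[j] y = g := by
    intro g n
    simp [attractor]
  have hconst : ∀ k, attractor w.T N = attractor w.T (N + k) := by
    intro k
    induction k with
    | zero => rfl
    | succ k ih => rw [ih, hN (N + k) (Nat.le_add_right _ _)]; rfl
  set m := N
  have g1 := w.lam_le_one (m + 1)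
  have g2 := w.lam_pos (m + 1 + 1)
  have g3 := w.lam_succ_lt (m + 1)
  have g4 := w.two_mul_lam_succ_le m
  have g5 := w.kap_lt_lam m
  have g6 := w.lam_le_one m
  -- `g` is missed by the return map of level `m + 1`, yet is the image of `z` under the second
  -- branch of level `m`, hence has preimages up to order `hh m > N`.
  let g : I := ⟨1 - w.lam (m + 1) + w.lam (m + 2), by linarith, by linarith⟩
  let z : I := ⟨1 - 2 * w.lam (m + 1) + w.lam (m + 2), by linarith, by linarith⟩
  have hz : w.T^[hh m] z = g := by
    refine Subtype.ext ?_
    rw [(w.level m).two.land z ⟨by change _ ≤ 1 - _ + _; linarith, by change 1 - _ + _ < _; linarith⟩]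
    change 1 - 2 * w.lam (m + 1) + w.lam (m + 2) + _ = 1 - w.lam (m + 1) + w.lam (m + 2)
    ring
  have hg : g ∈ attractor w.T N := by
    rw [hmem]
    intro j hj
    have hjm : j ≤ hh m := hj.trans (lt_hh m).le
    exact ⟨w.T^[hh m - j] z, by
      rw [← Function.iterate_add_apply, Nat.add_sub_cancel' hjm, hz]⟩
  obtain ⟨N₁, hN₁⟩ := w.exists_entry (m + 1)
  rw [hconst (N₁ + 1), hmem] at hg
  obtain ⟨y, hy⟩ := hg (N₁ + 1) (by omega)
  set q := N₁ + 1 with hq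
  -- From the last visit before time `q`, the first return would have to be `g`.
  let S : Finset ℕ := (Finset.range q).filter fun r => 1 - w.lam (m + 1) ≤ (w.T^[r] y : ℝ)
  have hS : S.Nonempty := by
    obtain ⟨r, hr, hry⟩ := hN₁ y
    exact ⟨r, Finset.mem_filter.2 ⟨Finset.mem_range.2 (by omega), hry⟩⟩
  obtain ⟨hr1, hr2⟩ := Finset.mem_filter.1 (S.max'_mem hS)
  set r := S.max' hS with hr
  rw [Finset.mem_range] at hr1
  obtain ⟨s, hs0, hsJ, hsn, hsg⟩ := w.first_return (m + 1) (w.T^[r] y) hr2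
  have hqr : w.T^[q - r] (w.T^[r] y) = g := by
    rw [← Function.iterate_add_apply, Nat.sub_add_cancel hr1.le, hy]
  rcases lt_trichotomy s (q - r) with h | h | h
  · rw [← Function.iterate_add_apply] at hsJ
    have := S.le_max' (s + r) (Finset.mem_filter.2 ⟨Finset.mem_range.2 (by omega), hsJ⟩)
    omega
  · rw [h, hqr] at hsg
    exact hsg rfl
  · have := hsn (q - r) (by omega) h
    rw [hqr] at this
    change 1 - w.lam (m + 1) + w.lam (m + 2) < _ at this
    linarith

/-! ### Points with prescribed digits -/

/-- The point of the `m`th renormalisation interval with digits `j m, j (m + 1), …`. -/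
noncomputable def pt (j : Digits) (m : ℕ) : I :=
  ⟨1 - tail (fun i => w.lam (i + 1)) j m, by
    have := w.digitWeight.tail_add_le j m
    have := w.kap_lt_lam m
    have := w.lam_le_one m
    have := w.lam_pos (m + 1)
    constructor <;> linarith [w.digitWeight.tail_pos j m]⟩

theorem pt_coe (j : Digits) (m : ℕ) :
    (w.pt j m : ℝ) = 1 - tail (fun i => w.lam (i + 1)) j m := rfl

theorem pt_eq (j : Digits) (m : ℕ) :
    (w.pt j m : ℝ) + j.dig m * w.lam (m + 1) = w.pt j (m + 1) := by
  rw [pt_coe, pt_coe, w.digitWeight.tail_eq j m]; ring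

theorem continuous_pt (m : ℕ) : Continuous fun j => w.pt j m :=
  (continuous_const.sub (w.digitWeight.continuous_tail m)).subtype_mk _

theorem le_pt (j : Digits) (m : ℕ) : 1 - w.kap m + w.lam (m + 1) ≤ w.pt j m := by
  rw [pt_coe]; linarith [w.digitWeight.tail_add_le j m]

theorem pt_lt (j : Digits) (m : ℕ) : (w.pt j m : ℝ) < 1 - w.lam (m + 1) := by
  rw [pt_coe, w.digitWeight.tail_eq j m]
  have h1 : (1 : ℝ) ≤ j.dig m := by exact_mod_cast j.one_le_dig m
  nlinarith [w.digitWeight.tail_pos j (m + 1), w.lam_pos (m + 1)]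

theorem pt_mem_two (j : Digits) (m : ℕ) :
    (w.pt j m : ℝ) ∈ Set.Ico (1 - w.kap m) (1 - w.lam (m + 1)) :=
  ⟨by linarith [w.le_pt j m, w.lam_pos (m + 1)], w.pt_lt j m⟩

/-- Repeated application of the second branch. -/
theorem iterate_two (m k : ℕ) (x : I) (h1 : 1 - w.kap m ≤ (x : ℝ))
    (h2 : (x : ℝ) + k * w.lam (m + 1) < 1) :
    (w.T^[k * hh m] x : ℝ) = x + k * w.lam (m + 1) := by
  have h0 := w.lam_pos (m + 1)
  have key : ∀ i < k, (x : ℝ) + i * w.lam (m + 1) < 1 - w.lam (m + 1) := by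
    intro i hi
    have hi' : (i : ℝ) + 1 ≤ k := by exact_mod_cast hi
    nlinarith
  refine (((w.level m).mono_J w (Set.empty_subset _)).two.iter (A := {(x : ℝ)}) k ?_
    fun _ _ _ _ => id).land x rfl
  rintro i hi _ rfl
  have : 0 ≤ (i : ℝ) * w.lam (m + 1) := by positivity
  exact ⟨by linarith, key i hi⟩

theorem iterate_dig (j : Digits) (m : ℕ) :
    w.T^[j.dig m * hh m] (w.pt j m) = w.pt j (m + 1) := by
  refine Subtype.ext ?_
  rw [w.iterate_two m _ _ (w.pt_mem_two j m).1, w.pt_eq j m]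
  rw [w.pt_eq j m]; exact (w.pt j (m + 1)).2.2

theorem iterate_entry (j : Digits) (m : ℕ) : w.T^[entry j m] (w.pt j 0) = w.pt j m := by
  induction m with
  | zero => simp [entry]
  | succ m ih =>
    rw [entry_succ, add_comm, Function.iterate_add_apply, ih, w.iterate_dig]

/-- The point with digits `j` lies in the tower over the second branch at every level. -/
theorem iterate_back (j : Digits) (m : ℕ) : ∀ z : I, (z : ℝ) = w.pt j m - w.lam (m + 1) →
    w.T^[hh m - entry j m] z = w.pt j 0 := by
  induction m with
  | zero =>
    intro z hz
    refine Subtype.ext ?_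
    have h1 := w.lam_pos 1
    have := w.iterate_two 0 1 z (by rw [hz]; linarith [w.le_pt j 0])
      (by rw [hz]; push_cast; linarith [(w.pt j 0).2.2])
    rw [one_mul] at this
    simp only [entry, Finset.range_zero, Finset.sum_empty, Nat.sub_zero]
    rw [this, hz]; push_cast; ring
  | succ m ih =>
    intro z hz
    have k1 := w.lam_pos (m + 1)
    have k2 := w.lam_pos (m + 1 + 1)
    have k3 := w.le_pt j (m + 1)
    have k4 := w.kap_lt_lam (m + 1)
    have k5 := w.kap_eq' m
    have k6 := w.pt_eq j m
    have k7 := w.pt_lt j m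
    have hP := ((w.level m).mono_J w (Set.empty_subset _)).prefix (fun y hy => hy.elim)
    have h1 := hP.land z ⟨by linarith, z.2.2⟩
    set u := w.T^[hc m + rep₁ m * ht m] z with hu
    -- Of the `rep₂ m` second-branch passes, `rep₂ m - j.dig m` lead to the base point of level `m`;
    -- the rest belongs to the entry time.
    have hd : j.dig m + 1 ≤ rep₂ m := j.dig_lt m
    have hcast : ((rep₂ m - j.dig m : ℕ) : ℝ) = rep₂ m - j.dig m := by
      rw [Nat.cast_sub (by omega)]
    have hsum : (u : ℝ) + ((rep₂ m - j.dig m : ℕ) : ℝ) * w.lam (m + 1) =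
        w.pt j m - w.lam (m + 1) := by
      rw [hcast, h1, hz]; linarith
    have h2 := w.iterate_two m (rep₂ m - j.dig m) u (by linarith) (by rw [hsum]; linarith)
    have h3 := ih _ (h2.trans hsum)
    rw [hu, ← Function.iterate_add_apply, ← Function.iterate_add_apply] at h3
    convert h3 using 2
    have a1 := entry_add_lt j m
    rw [entry_succ, hh_succ, hc_succ_eq_word, Nat.sub_mul]
    have a2 : j.dig m * hh m ≤ rep₂ m * hh m := Nat.mul_le_mul_right _ (by omega)
    omega

theorem exists_base (j : Digits) (m : ℕ) : ∃ z : I, (z : ℝ) = w.pt j m - w.lam (m + 1) := by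
  have h1 := w.le_pt j m
  have h2 := w.pt_lt j m
  have h3 := w.lam_pos (m + 1)
  have h4 := w.kap_lt_lam m
  have h5 := w.lam_le_one m
  exact ⟨⟨w.pt j m - w.lam (m + 1), by linarith, by linarith⟩, rfl⟩

end Widths

/-! ### Coincidences of orbits in the interval -/

theorem le_entry (j : Digits) (m : ℕ) : m ≤ entry j m := by
  induction m with
  | zero => exact Nat.zero_le _
  | succ m ih =>
    rw [entry_succ]
    have := Nat.mul_le_mul (j.one_le_dig m) (hh_pos m)
    omega

theorem dig_eq_of_entry {j j' : Digits} {n n' m₀ : ℕ}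
    (h : ∀ m, m₀ ≤ m → entry j m + n' = entry j' m + n) (m : ℕ) (hm : m₀ ≤ m) :
    j.dig m = j'.dig m := by
  have h1 := h m hm
  have h2 := h (m + 1) (by omega)
  rw [entry_succ, entry_succ] at h2
  exact Nat.eq_of_mul_eq_mul_right (hh_pos m) (by omega)

theorem tail_congr (e : ℕ → ℝ) {j j' : Digits} {m₀ : ℕ}
    (h : ∀ m, m₀ ≤ m → j.dig m = j'.dig m) (m : ℕ) (hm : m₀ ≤ m) : tail e j m = tail e j' m := by
  unfold tail
  congr 1
  funext i
  rw [h (m + i) (by omega)]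

namespace Widths

variable (w : Widths)

/-- Equal tails give the same base point at level `m₀`, and both points lie on its forward orbit
(`iterate_back`) at times differing by `n`. -/
theorem iterate_pt_of_entry {j j' : Digits} {n m₀ : ℕ}
    (h : ∀ m, m₀ ≤ m → entry j m = entry j' m + n) : w.T^[n] (w.pt j 0) = w.pt j' 0 := by
  have hpt : w.pt j m₀ = w.pt j' m₀ := by
    refine Subtype.ext ?_
    rw [pt_coe, pt_coe,
      tail_congr _ (fun m hm => dig_eq_of_entry (n' := 0) (n := n) h m hm) m₀ le_rfl]
  obtain ⟨z, hz⟩ := w.exists_base j m₀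
  rw [← w.iterate_back j m₀ z hz, ← w.iterate_back j' m₀ z (by rw [← hpt]; exact hz),
    ← Function.iterate_add_apply]
  have h1 := h m₀ le_rfl
  have h2 := entry_add_lt j m₀
  congr 2
  omega

/-- Otherwise `pt j m` would return to the level `m` interval, at `pt j' m`, before the return time
`hh m`. -/
theorem entry_of_iterate_pt_aux {j j' : Digits} {n n' m : ℕ}
    (h : w.T^[n] (w.pt j 0) = w.T^[n'] (w.pt j' 0)) (hm : n + n' ≤ m)
    (hle : entry j m + n' ≤ entry j' m + n) : entry j m + n' = entry j' m + n := by
  by_contra hne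
  have e1 := le_entry j m
  have e2 := le_entry j' m
  have e3 := entry_add_lt j' m
  set s := (entry j' m - n') - (entry j m - n) with hs
  have h1 : w.T^[entry j m - n] (w.T^[n] (w.pt j 0)) = w.pt j m := by
    rw [← Function.iterate_add_apply, Nat.sub_add_cancel (by omega), w.iterate_entry]
  have h2 : w.T^[s] (w.pt j m) = w.pt j' m := by
    rw [← h1, h, ← Function.iterate_add_apply, ← Function.iterate_add_apply,
      show s + (entry j m - n) + n' = entry j' m by omega, w.iterate_entry]
  have h3 := (w.level m).two.noret s (by omega) (by omega) _ (w.pt_mem_two j m)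
  rw [h2] at h3
  exact h3 (by
    have := (w.pt_mem_two j' m).1
    have := w.kap_lt_lam m
    change 1 - w.lam m ≤ _
    linarith)

theorem entry_of_iterate_pt {j j' : Digits} {n n' : ℕ}
    (h : w.T^[n] (w.pt j 0) = w.T^[n'] (w.pt j' 0)) (m : ℕ) (hm : n + n' ≤ m) :
    entry j m + n' = entry j' m + n := by
  rcases le_total (entry j m + n') (entry j' m + n) with hle | hle
  · exact w.entry_of_iterate_pt_aux h hm hle
  · exact (w.entry_of_iterate_pt_aux h.symm (by omega) hle).symm

end Widths

/-! ### A Cantor set of positive measure in the circle -/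

/-- The rotation angle as a point of the circle. -/
noncomputable def ang : UnitAddCircle := (gam : ℝ)

/-- The point of the circle with digits `j`. -/
noncomputable def cpt (j : Digits) : UnitAddCircle := ((-tail disp j 0 : ℝ) : UnitAddCircle)

theorem continuous_cpt : Continuous cpt :=
  (AddCircle.continuous_mk' 1).comp (digitWeight_disp.continuous_tail 0).neg

theorem nsmul_ang (n : ℕ) : n • ang = ((n * gam : ℝ) : UnitAddCircle) := by
  rw [ang, ← AddCircle.coe_nsmul, nsmul_eq_mul]

theorem coe_int_eq_zero (n : ℤ) : ((n : ℝ) : UnitAddCircle) = 0 :=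
  (AddCircle.coe_eq_zero_iff 1).2 ⟨n, by simp⟩

/-- Modulo integers `hh i * gam` is `disp i`, so rotating for the entry time cancels the first `m`
digits. -/
theorem cpt_add_entry (j : Digits) (m : ℕ) :
    cpt j + entry j m • ang = ((-tail disp j m : ℝ) : UnitAddCircle) := by
  rw [cpt, nsmul_ang, ← AddCircle.coe_add, digitWeight_disp.tail_zero_eq j m]
  have h : -(∑ i ∈ Finset.range m, (j.dig i : ℝ) * disp i + tail disp j m) + entry j m * gam =
      -tail disp j m + ((∑ i ∈ Finset.range m, (j.dig i : ℤ) * hp i : ℤ) : ℝ) := by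
    have : ∑ i ∈ Finset.range m, (j.dig i : ℝ) * disp i =
        entry j m * gam - ((∑ i ∈ Finset.range m, (j.dig i : ℤ) * hp i : ℤ) : ℝ) := by
      unfold entry disp
      push_cast
      rw [Finset.sum_mul, ← Finset.sum_sub_distrib]
      exact Finset.sum_congr rfl fun i _ => by ring
    rw [this]; ring
  rw [h, AddCircle.coe_add, coe_int_eq_zero, add_zero]

/-- Points of the Cantor set lying on the same orbit have the same entry times, up to a shift. -/
theorem entry_of_cpt {j j' : Digits} {n : ℕ} (h : cpt j' = cpt j + n • ang) (m : ℕ) (hm : n ≤ m) :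
    entry j m = entry j' m + n := by
  by_contra hne
  set N : ℤ := (n : ℤ) + entry j' m - entry j m with hN
  have h1 : ((N * gam : ℝ) : UnitAddCircle) =
      ((tail disp j m - tail disp j' m : ℝ) : UnitAddCircle) := by
    have e1 : ((N * gam : ℝ)) = n * gam + entry j' m * gam - entry j m * gam := by
      rw [hN]; push_cast; ring
    rw [e1, AddCircle.coe_sub, AddCircle.coe_add, ← nsmul_ang, ← nsmul_ang, ← nsmul_ang]
    have h2 := cpt_add_entry j m
    have h3 := cpt_add_entry j' m
    rw [AddCircle.coe_neg] at h2 h3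
    rw [AddCircle.coe_sub, ← neg_eq_iff_eq_neg.2 h2, ← neg_eq_iff_eq_neg.2 h3, h]
    abel
  rw [← sub_eq_zero, ← AddCircle.coe_sub, AddCircle.coe_eq_zero_iff] at h1
  obtain ⟨P, hP⟩ := h1
  have b1 := entry_add_lt j m
  have b2 := entry_add_lt j' m
  -- The lower bound `1 / hh m - disp m` contradicts the upper bound `back m - 2 * disp m` for the
  -- difference of tails.
  have hs := sep_gam m N P (by omega) (by rw [abs_lt]; constructor <;> omega)
  have e2 : N * gam - P = tail disp j m - tail disp j' m := by
    simp only [zsmul_eq_mul, mul_one] at hP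
    linarith
  rw [e2] at hs
  have := digitWeight_disp.abs_tail_sub_le j j' m
  have := back_le m
  have := disp_pos m
  linarith

theorem cpt_injective : Function.Injective cpt := by
  intro j j' h
  have := entry_of_cpt (j := j) (j' := j') (n := 0) (by simp [h])
  refine Digits.ext_dig fun m =>
    dig_eq_of_entry (n := 0) (n' := 0) (m₀ := 0) (fun m _ => this m (Nat.zero_le m)) m
      (Nat.zero_le m)

theorem cpt_add_eq {j j' : Digits} {n n' m₀ : ℕ}
    (h : ∀ m, m₀ ≤ m → entry j m + n' = entry j' m + n) : cpt j + n • ang = cpt j' + n' • ang := by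
  have h1 := cpt_add_entry j m₀
  have h2 := cpt_add_entry j' m₀
  rw [← tail_congr disp (dig_eq_of_entry h) m₀ le_rfl, ← h1] at h2
  have h3 : entry j m₀ • ang + n' • ang = entry j' m₀ • ang + n • ang := by
    rw [← add_nsmul, ← add_nsmul, h m₀ le_rfl]
  have h4 : cpt j + n • ang + entry j m₀ • ang = cpt j' + n' • ang + entry j m₀ • ang := by
    calc cpt j + n • ang + entry j m₀ • ang = (cpt j + entry j m₀ • ang) + n • ang := by abel
      _ = cpt j' + (entry j' m₀ • ang + n • ang) := by rw [← h2]; abel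
      _ = _ := by rw [← h3]; abel
  exact add_right_cancel h4

/-- Digits with a given prefix, continued by the smallest digits. -/
def extendPrefix (n : ℕ) (a : ∀ i : Fin n, Fin (rep₂ i - 1)) : Digits := fun i =>
  if h : i < n then a ⟨i, h⟩ else ⟨0, by have := thirtytwo_le_rep₂ i; omega⟩

/-- With a common tail the two points differ by a nonzero multiple of `ang` of order below `hh n`,
so `sep_gam` applies. -/
theorem le_dist_cpt {n : ℕ} {a b : ∀ i : Fin n, Fin (rep₂ i - 1)} (hab : a ≠ b) :
    1 / (hh n : ℝ) - disp n ≤ dist (cpt (extendPrefix n a)) (cpt (extendPrefix n b)) := by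
  set j := extendPrefix n a
  set j' := extendPrefix n b
  have htail : ∀ m, n ≤ m → j.dig m = j'.dig m := by
    intro m hm
    simp [j, j', Digits.dig, extendPrefix, not_lt.2 hm]
  have h1 := cpt_add_entry j n
  have h2 := cpt_add_entry j' n
  rw [← tail_congr disp htail n le_rfl, ← h1] at h2
  have h3 : cpt j - cpt j' = ((((entry j' n : ℤ) - entry j n : ℤ) * gam : ℝ) : UnitAddCircle) := by
    push_cast
    rw [sub_mul, AddCircle.coe_sub, ← nsmul_ang, ← nsmul_ang, sub_eq_sub_iff_add_eq_add, ← h2]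
    abel
  have hne : (entry j' n : ℤ) - entry j n ≠ 0 := by
    intro h0
    have h4 : cpt j = cpt j' := by
      rw [← sub_eq_zero, h3, h0]; simp
    apply hab
    have h5 := cpt_injective h4
    funext i
    have := congrFun h5 i
    simpa [j, j', extendPrefix, i.2] using this
  rw [dist_eq_norm, h3, UnitAddCircle.norm_eq]
  refine sep_gam n _ _ hne ?_
  have b1 := entry_add_lt j n
  have b2 := entry_add_lt j' n
  rw [abs_lt]; constructor <;> omega

theorem hh_mul_disp_le (n : ℕ) : hh n * disp n ≤ 1 / 32 := by
  have h1 := disp_le n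
  have h2 : 32 * hh n ≤ hc (n + 1) := by
    rw [hc_succ]
    have : 32 ≤ quot n := (thirtytwo_le_rep₂ n).trans (Nat.le_add_right _ _)
    exact (Nat.mul_le_mul_right _ this).trans (Nat.le_add_left _ _)
  have h3 : (32 * hh n : ℝ) ≤ hc (n + 1) := by exact_mod_cast h2
  have h4 : (0 : ℝ) < hh n := by exact_mod_cast hh_pos n
  rw [le_div_iff₀ (by linarith)] at h1
  nlinarith [disp_pos n]

/-- At least `hh n / 2` disjoint balls of length nearly `1 / hh n` fit into the thickening. -/
theorem volume_cthickening_ge (n : ℕ) : ENNReal.ofReal (1 / 4) ≤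
    volume (Metric.cthickening ((1 / (hh n : ℝ) - disp n) / 2) (Set.range cpt)) := by
  have hpos : (0 : ℝ) < hh n := by exact_mod_cast hh_pos n
  have hE := hh_mul_disp_le n
  have hE0 := disp_pos n
  set r : ℝ := (1 / (hh n : ℝ) - disp n) / 2 with hr
  have hhr : hh n * (2 * r) = 1 - hh n * disp n := by rw [hr]; field_simp
  have hr0 : 0 < r := by
    have : 0 < hh n * (2 * r) := by rw [hhr]; linarith
    have := (mul_pos_iff_of_pos_left hpos).1 this
    linarith
  have hr1 : 2 * r ≤ 1 := by
    have h1 : (1 : ℝ) ≤ hh n := by exact_mod_cast hh_pos n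
    nlinarith [mul_pos hpos hE0]
  let P := ∀ i : Fin n, Fin (rep₂ i - 1)
  have hsub : (⋃ a : P, Metric.ball (cpt (extendPrefix n a)) r) ⊆
      Metric.cthickening r (Set.range cpt) :=
    Set.iUnion_subset fun a => Metric.ball_subset_closedBall.trans
      (Metric.closedBall_subset_cthickening (Set.mem_range_self _) r)
  have hdisj : Pairwise (Function.onFun Disjoint
      fun a : P => Metric.ball (cpt (extendPrefix n a)) r) := fun a b hab =>
    Metric.ball_disjoint_ball (by have := le_dist_cpt hab; rw [hr]; linarith)
  have hvol : ∀ x : UnitAddCircle, volume (Metric.ball x r) = ENNReal.ofReal (2 * r) := by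
    intro x
    rw [← measure_congr (AddCircle.closedBall_ae_eq_ball (x := x) (ε := r)),
      AddCircle.volume_closedBall, min_eq_right hr1]
  have hcard : (Fintype.card P : ℝ) = ∏ i ∈ Finset.range n, ((rep₂ i : ℝ) - 1) := by
    rw [Fintype.card_pi, ← Fin.prod_univ_eq_prod_range (fun i => (rep₂ i : ℝ) - 1) n]
    push_cast
    refine Finset.prod_congr rfl fun i _ => ?_
    rw [Fintype.card_fin, Nat.cast_sub (by have := thirtytwo_le_rep₂ i; omega)]; simp
  refine le_trans ?_ (measure_mono hsub)
  rw [measure_iUnion hdisj fun _ => measurableSet_ball, tsum_fintype]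
  simp only [hvol, Finset.sum_const, Finset.card_univ, nsmul_eq_mul]
  rw [← ENNReal.ofReal_natCast, ← ENNReal.ofReal_mul (Nat.cast_nonneg _), hcard]
  apply ENNReal.ofReal_le_ofReal
  have h1 := prod_rep₂_ge n
  have h2 : (0 : ℝ) ≤ 1 / 2 ^ (n + 1) := by positivity
  have h3 : (hh n : ℝ) * (1 / 2) ≤ ∏ i ∈ Finset.range n, ((rep₂ i : ℝ) - 1) := by nlinarith
  nlinarith [mul_le_mul_of_nonneg_right h3 (by linarith : 0 ≤ 2 * r)]

theorem volume_range_cpt_pos : 0 < volume (Set.range cpt) := by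
  have hK : IsCompact (Set.range cpt) := isCompact_range continuous_cpt
  have hlim : Tendsto (fun n : ℕ => (1 / (hh n : ℝ) - disp n) / 2) atTop (𝓝 0) := by
    have h1 : Tendsto (fun n : ℕ => 1 / (hh n : ℝ)) atTop (𝓝 0) := by
      refine squeeze_zero' (Eventually.of_forall fun n => by positivity) ?_
        tendsto_one_div_atTop_nhds_zero_nat
      filter_upwards [eventually_gt_atTop 0] with n hn
      exact one_div_le_one_div_of_le (by exact_mod_cast hn) (by exact_mod_cast (lt_hh n).le)
    have h2 : Tendsto disp atTop (𝓝 0) := by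
      refine squeeze_zero' (Eventually.of_forall fun n => disp_nonneg n) ?_
        tendsto_one_div_atTop_nhds_zero_nat
      filter_upwards [eventually_gt_atTop 0] with n hn
      exact (disp_lt n hn).le
    simpa using (h1.sub h2).div_const 2
  have h := ge_of_tendsto ((tendsto_measure_cthickening_of_isCompact (μ := volume) hK).comp hlim)
    (Eventually.of_forall volume_cthickening_ge)
  exact (by simp : (0 : ENNReal) < ENNReal.ofReal (1 / 4)).trans_le h

/-! ### The orbit of the Cantor set has full measure -/

theorem ergodic_rotation : Ergodic (rotation gam) (volume : Measure UnitAddCircle) := by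
  refine AddCircle.ergodic_add_right.2 ?_
  rw [addOrderOf_eq_zero_iff']
  intro n hn h0
  change n • ang = 0 at h0
  rw [nsmul_ang, AddCircle.coe_eq_zero_iff] at h0
  obtain ⟨k, hk⟩ := h0
  simp only [zsmul_eq_mul, mul_one] at hk
  have hn' : (n : ℝ) ≠ 0 := by exact_mod_cast hn.ne'
  exact irrational_gam ⟨(k : ℚ) / n, by push_cast; rw [hk]; field_simp⟩

/-- The forward orbit of the Cantor set. -/
def fullSet : Set UnitAddCircle := ⋃ n : ℕ, (fun y : UnitAddCircle => y + n • ang) '' Set.range cpt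

theorem mem_fullSet {y : UnitAddCircle} : y ∈ fullSet ↔ ∃ (n : ℕ) (j : Digits), y = cpt j + n • ang := by
  simp [fullSet, ← sub_eq_add_neg, eq_sub_iff_add_eq, eq_comm]

theorem measurableSet_piece (n : ℕ) :
    MeasurableSet ((fun y : UnitAddCircle => y + n • ang) '' Set.range cpt) :=
  ((isCompact_range continuous_cpt).image (continuous_add_const _)).isClosed.measurableSet

theorem measurableSet_fullSet : MeasurableSet fullSet :=
  MeasurableSet.iUnion measurableSet_piece

theorem mapsTo_fullSet : Set.MapsTo (rotation gam) fullSet fullSet := by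
  intro y hy
  obtain ⟨n, j, rfl⟩ := mem_fullSet.1 hy
  exact mem_fullSet.2 ⟨n + 1, j, by rw [succ_nsmul, ← add_assoc]; rfl⟩

theorem volume_compl_fullSet : volume fullSetᶜ = 0 := by
  rcases ergodic_rotation.ae_empty_or_univ_of_image_ae_le measurableSet_fullSet.nullMeasurableSet
    (LE.le.eventuallyLE mapsTo_fullSet.image_subset) with h | h
  · exfalso
    have h1 : volume fullSet = 0 := by rw [measure_congr h]; simp
    have h2 : Set.range cpt ⊆ fullSet := by
      rintro _ ⟨j, rfl⟩
      exact mem_fullSet.2 ⟨0, j, by simp⟩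
    exact (volume_range_cpt_pos.trans_le (measure_mono h2)).ne' h1
  · rwa [← ae_eq_univ]

theorem measurable_map (p : Param) : Measurable p.map := by
  refine Measurable.subtype_mk ?_
  unfold formula
  refine Measurable.ite (measurableSet_lt measurable_subtype_coe measurable_const) (by fun_prop) ?_
  exact Measurable.ite (measurableSet_lt measurable_subtype_coe measurable_const) (by fun_prop)
    (by fun_prop)

namespace Widths

variable (w : Widths)

/-! ### The section of the rotation -/

theorem iterate_pt_eq_aux {j j' : Digits} {n n' : ℕ} (hn : n' ≤ n)
    (h : cpt j + n • ang = cpt j' + n' • ang) : w.T^[n] (w.pt j 0) = w.T^[n'] (w.pt j' 0) := by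
  obtain ⟨k, rfl⟩ := Nat.exists_eq_add_of_le hn
  have h1 : cpt j' = cpt j + k • ang := by
    rw [add_nsmul] at h
    have : cpt j + k • ang + n' • ang = cpt j' + n' • ang := by rw [← h]; abel
    exact (add_right_cancel this).symm
  rw [Function.iterate_add_apply, w.iterate_pt_of_entry (entry_of_cpt h1)]

theorem iterate_pt_eq {j j' : Digits} {n n' : ℕ}
    (h : cpt j + n • ang = cpt j' + n' • ang) : w.T^[n] (w.pt j 0) = w.T^[n'] (w.pt j' 0) := by
  rcases le_total n' n with hn | hn
  · exact w.iterate_pt_eq_aux hn h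
  · exact (w.iterate_pt_eq_aux hn h.symm).symm

open Classical in
/-- The equivariant map from the circle to the interval, defined on `fullSet`. -/
noncomputable def sec (y : UnitAddCircle) : I :=
  if h : ∃ a : ℕ × Digits, y = cpt a.2 + a.1 • ang then w.T^[h.choose.1] (w.pt h.choose.2 0)
  else ⟨0, by simp⟩

theorem sec_apply (n : ℕ) (j : Digits) : w.sec (cpt j + n • ang) = w.T^[n] (w.pt j 0) := by
  have h : ∃ a : ℕ × Digits, cpt j + n • ang = cpt a.2 + a.1 • ang := ⟨(n, j), rfl⟩
  rw [sec, dif_pos h]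
  exact (w.iterate_pt_eq h.choose_spec).symm

theorem sec_injOn : Set.InjOn w.sec fullSet := by
  intro y hy y' hy' h
  obtain ⟨n, j, rfl⟩ := mem_fullSet.1 hy
  obtain ⟨n', j', rfl⟩ := mem_fullSet.1 hy'
  rw [sec_apply, sec_apply] at h
  exact cpt_add_eq (w.entry_of_iterate_pt h)

theorem sec_rotation {y : UnitAddCircle} (hy : y ∈ fullSet) :
    w.sec (rotation gam y) = w.T (w.sec y) := by
  obtain ⟨n, j, rfl⟩ := mem_fullSet.1 hy
  have : rotation gam (cpt j + n • ang) = cpt j + (n + 1) • ang := by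
    rw [succ_nsmul, ← add_assoc]; rfl
  rw [this, sec_apply, sec_apply, Function.iterate_succ_apply']

theorem measurable_sec : Measurable w.sec := by
  -- `b` extends `pt · 0 ∘ cpt⁻¹` measurably, so on the `n`th piece `sec` is `T^[n] (b (y - n •
  -- ang))`.
  obtain ⟨b, hb, hbc⟩ := (continuous_cpt.isClosedEmbedding
    cpt_injective).measurableEmbedding.exists_measurable_extend (w.continuous_pt 0).measurable
      fun _ => ⟨⟨0, by simp⟩⟩
  have hbc' : ∀ j, b (cpt j) = w.pt j 0 := fun j => congrFun hbc j
  intro s hs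
  have key : w.sec ⁻¹' s = (⋃ n : ℕ, (fun y : UnitAddCircle => y + n • ang) '' Set.range cpt ∩
      {y | w.T^[n] (b (y - n • ang)) ∈ s}) ∪ (fullSetᶜ ∩ {_y | (⟨0, by simp⟩ : I) ∈ s}) := by
    ext y
    by_cases hy : y ∈ fullSet
    · simp only [Set.mem_preimage, Set.mem_union, Set.mem_iUnion, Set.mem_inter_iff,
        Set.mem_compl_iff, hy, not_true, false_and, or_false, Set.mem_ofPred_eq]
      constructor
      · intro h
        obtain ⟨n, j, rfl⟩ := mem_fullSet.1 hy
        refine ⟨n, ⟨_, ⟨j, rfl⟩, rfl⟩, ?_⟩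
        rwa [add_sub_cancel_right, hbc', ← sec_apply]
      · rintro ⟨n, ⟨_, ⟨j, rfl⟩, rfl⟩, h⟩
        simp only [add_sub_cancel_right, hbc'] at h
        rwa [sec_apply]
    · have h0 : ¬ ∃ a : ℕ × Digits, y = cpt a.2 + a.1 • ang := fun ⟨a, ha⟩ =>
        hy (mem_fullSet.2 ⟨a.1, a.2, ha⟩)
      have h1 : w.sec y = ⟨0, by simp⟩ := by rw [sec, dif_neg h0]
      have h2 : ∀ n : ℕ, y ∉ (fun y : UnitAddCircle => y + n • ang) '' Set.range cpt :=
        fun n hn => hy (Set.mem_iUnion.2 ⟨n, hn⟩)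
      simp only [Set.mem_preimage, h1, Set.mem_union, Set.mem_iUnion, Set.mem_inter_iff, h2,
        false_and, exists_false, false_or, Set.mem_compl_iff, hy, not_false_eq_true, true_and,
        Set.mem_ofPred_eq]
  rw [key]
  refine (MeasurableSet.iUnion fun n => (measurableSet_piece n).inter ?_).union
    (measurableSet_fullSet.compl.inter (MeasurableSet.const _))
  exact ((measurable_map w.param).iterate n).comp (hb.comp (measurable_id.sub_const _)) hs

/-- The invariant measure. -/
noncomputable def mu : Measure I := Measure.map w.sec volume

theorem measurePreserving_sec : MeasurePreserving w.sec volume w.mu :=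
  ⟨w.measurable_sec, rfl⟩

instance isProbabilityMeasure_mu : IsProbabilityMeasure w.mu :=
  have : IsProbabilityMeasure (volume : Measure UnitAddCircle) := ⟨UnitAddCircle.measure_univ⟩
  Measure.isProbabilityMeasure_map w.measurable_sec.aemeasurable

theorem measurePreserving_map : MeasurePreserving w.T w.mu w.mu := by
  refine ⟨measurable_map w.param, ?_⟩
  have hrot := ergodic_rotation.toMeasurePreserving
  rw [mu, Measure.map_map (measurable_map w.param) w.measurable_sec]
  have : w.T ∘ w.sec =ᵐ[volume] w.sec ∘ rotation gam := by
    filter_upwards [compl_mem_ae_iff.2 volume_compl_fullSet] with y hy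
    rw [compl_compl] at hy
    exact (w.sec_rotation hy).symm
  rw [Measure.map_congr this, ← Measure.map_map w.measurable_sec hrot.measurable, hrot.map_eq]

/-- An injective measurable map between standard Borel spaces is a measurable embedding
(Lusin–Souslin), so its inverse extends measurably. -/
theorem exists_factor : ∃ φ : I → UnitAddCircle, Measurable φ ∧ ∀ y ∈ fullSet, φ (w.sec y) = y := by
  have : StandardBorelSpace fullSet := measurableSet_fullSet.standardBorel
  have he : MeasurableEmbedding (fun y : fullSet => w.sec y) :=
    (w.measurable_sec.comp measurable_subtype_coe).measurableEmbedding
      fun a b h => Subtype.ext (w.sec_injOn a.2 b.2 h)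
  obtain ⟨φ, hφ, h⟩ := he.exists_measurable_extend measurable_subtype_coe fun _ => ⟨0⟩
  exact ⟨φ, hφ, fun y hy => congrFun h ⟨y, hy⟩⟩

/-- The interval map with its measure is isomorphic to the rotation. -/
theorem exists_isomorphism : ∃ φ : I → UnitAddCircle,
    MeasurePreserving φ w.mu volume ∧
    MeasurableSet (w.sec '' fullSet) ∧ w.mu (w.sec '' fullSet)ᶜ = 0 ∧
    Set.MapsTo w.T (w.sec '' fullSet) (w.sec '' fullSet) ∧
    (∀ y ∈ fullSet, φ (w.sec y) = y) ∧
    ∀ x ∈ w.sec '' fullSet, φ (w.T x) = rotation gam (φ x) := by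
  obtain ⟨φ, hφ, hinv⟩ := w.exists_factor
  have hX : MeasurableSet (w.sec '' fullSet) :=
    measurableSet_fullSet.image_of_measurable_injOn w.measurable_sec w.sec_injOn
  refine ⟨φ, ⟨hφ, ?_⟩, hX, ?_, ?_, hinv, ?_⟩
  · rw [mu, Measure.map_map hφ w.measurable_sec]
    have : φ ∘ w.sec =ᵐ[volume] id := by
      filter_upwards [compl_mem_ae_iff.2 volume_compl_fullSet] with y hy
      rw [compl_compl] at hy
      exact hinv y hy
    rw [Measure.map_congr this, Measure.map_id]
  · rw [mu, Measure.map_apply w.measurable_sec hX.compl]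
    refine measure_mono_null (fun y hy hyF => hy ⟨y, hyF, rfl⟩) volume_compl_fullSet
  · rintro _ ⟨y, hy, rfl⟩
    exact ⟨rotation gam y, mapsTo_fullSet hy, w.sec_rotation hy⟩
  · rintro _ ⟨y, hy, rfl⟩
    rw [← w.sec_rotation hy, hinv _ (mapsTo_fullSet hy), hinv y hy]

/-! ### Unique ergodicity -/

theorem abs_average_integral_sub_le {f : I → ℝ} (hf : Continuous f) {B : ℝ} (hB : ∀ x, |f x| ≤ B)
    {a ε : ℝ} {n : ℕ}
    (h : ∀ x, |(n : ℝ)⁻¹ * ∑ q ∈ Finset.range n, f (w.T^[q] x) - a| ≤ ε)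
    (ρ : Measure I) [IsProbabilityMeasure ρ] :
    |(n : ℝ)⁻¹ * ∑ q ∈ Finset.range n, ∫ x, f (w.T^[q] x) ∂ρ - a| ≤ ε := by
  have hint : ∀ q, Integrable (fun x => f (w.T^[q] x)) ρ := fun q =>
    Integrable.of_bound
      (hf.measurable.comp ((measurable_map w.param).iterate q)).aestronglyMeasurable B
      (Eventually.of_forall fun x => hB _)
  rw [← integral_finsetSum _ fun q _ => hint q, ← integral_const_mul]
  have hint' : Integrable (fun x => (n : ℝ)⁻¹ * ∑ q ∈ Finset.range n, f (w.T^[q] x)) ρ :=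
    (integrable_finsetSum _ fun q _ => hint q).const_mul _
  have e1 : ∫ x, (n : ℝ)⁻¹ * ∑ q ∈ Finset.range n, f (w.T^[q] x) ∂ρ - a =
      ∫ x, ((n : ℝ)⁻¹ * ∑ q ∈ Finset.range n, f (w.T^[q] x) - a) ∂ρ := by
    rw [integral_sub hint' (integrable_const a)]; simp
  rw [e1, ← Real.norm_eq_abs]
  exact (norm_integral_le_of_norm_le_const (Eventually.of_forall h)).trans (by simp)

theorem average_integral_of_invariant {f : I → ℝ} (hf : Continuous f) {n : ℕ} (hn : 0 < n)
    {ρ : Measure I} (hρ : MeasurePreserving w.T ρ ρ) :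
    (n : ℝ)⁻¹ * ∑ q ∈ Finset.range n, ∫ x, f (w.T^[q] x) ∂ρ = ∫ x, f x ∂ρ := by
  have : ∀ q, ∫ x, f (w.T^[q] x) ∂ρ = ∫ x, f x ∂ρ := fun q => by
    have h := hρ.iterate q
    conv_rhs => rw [← h.map_eq]
    rw [integral_map h.measurable.aemeasurable hf.measurable.aestronglyMeasurable]
  have hn' : (n : ℝ) ≠ 0 := by exact_mod_cast hn.ne'
  simp only [this, Finset.sum_const, Finset.card_range, nsmul_eq_mul]
  field_simp

/-- Averages of any initial distribution converge to the integral against an invariant one. -/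
theorem tendsto_average_integral {f : I → ℝ} {K : NNReal} (hf : LipschitzWith K f) {B : ℝ}
    (hB : ∀ x, |f x| ≤ B) (ρ μ : Measure I) [IsProbabilityMeasure ρ] [IsProbabilityMeasure μ]
    (hμ : MeasurePreserving w.T μ μ) :
    Tendsto (fun n : ℕ => (n : ℝ)⁻¹ * ∑ q ∈ Finset.range n, ∫ x, f (w.T^[q] x) ∂ρ) atTop
      (𝓝 (∫ x, f x ∂μ)) := by
  rw [Metric.tendsto_nhds]
  intro ε hε
  obtain ⟨a, ha⟩ := w.eventually_average hf hB (show 0 < ε / 3 by linarith)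
  filter_upwards [ha, eventually_gt_atTop 0] with n hn hn0
  have h1 := w.abs_average_integral_sub_le hf.continuous hB hn ρ
  have h2 := w.abs_average_integral_sub_le hf.continuous hB hn μ
  rw [w.average_integral_of_invariant hf.continuous hn0 hμ] at h2
  rw [Real.dist_eq]
  rw [abs_le] at h1 h2
  rw [abs_lt]
  constructor <;> linarith

theorem exists_bound_of_dist {f : I → ℝ} (hf : ∃ C : ℝ, ∀ x y, dist (f x) (f y) ≤ C) :
    ∃ B, ∀ x, |f x| ≤ B := by
  obtain ⟨C, hC⟩ := hf
  let z : I := ⟨0, by simp⟩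
  refine ⟨C + |f z|, fun x => ?_⟩
  have := abs_sub_abs_le_abs_sub (f x) (f z)
  have h2 := hC x z
  rw [Real.dist_eq] at h2
  linarith

/-- The averages started from `ν` converge to the integrals against both measures, and bounded
Lipschitz functions separate probability measures. -/
theorem eq_mu (ν : Measure I) (hν : IsProbabilityMeasure ν) (hT : MeasurePreserving w.T ν ν) :
    ν = w.mu := by
  let ν' : ProbabilityMeasure I := ⟨ν, hν⟩
  let μ' : ProbabilityMeasure I := ⟨w.mu, w.isProbabilityMeasure_mu⟩
  have h : Tendsto (fun _ : ℕ => ν') atTop (𝓝 μ') := by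
    rw [tendsto_iff_forall_lipschitz_integral_tendsto]
    rintro f hf ⟨K, hK⟩
    obtain ⟨B, hB⟩ := exists_bound_of_dist hf
    have h1 := w.tendsto_average_integral hK hB ν w.mu w.measurePreserving_map
    have h2 := w.tendsto_average_integral hK hB ν ν hT
    have h3 : ∫ x, f x ∂ν = ∫ x, f x ∂w.mu := tendsto_nhds_unique h2 h1
    change Tendsto (fun _ : ℕ => ∫ x, f x ∂ν) atTop (𝓝 (∫ x, f x ∂w.mu))
    rw [h3]
    exact tendsto_const_nhds
  have : ν' = μ' := tendsto_nhds_unique tendsto_const_nhds h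
  exact congrArg (fun m : ProbabilityMeasure I => (m : Measure I)) this

end Widths

/-! ### Convergence of the averages of Lebesgue measure -/

instance isProbabilityMeasure_lebesgue : IsProbabilityMeasure lebesgue := by
  constructor
  rw [lebesgue, comap_subtype_coe_apply measurableSet_Ico, Set.image_univ, Subtype.range_coe,
    Real.volume_Ico]
  simp

namespace Widths

variable (w : Widths)

/-- The average of the first `n + 1` images of Lebesgue measure. -/
noncomputable def avgLebesgue (n : ℕ) : Measure I :=
  ((n + 1 : ℕ) : NNReal)⁻¹ • ∑ q ∈ Finset.range (n + 1), Measure.map w.T^[q] lebesgue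

theorem measurable_iterate (q : ℕ) : Measurable w.T^[q] := (measurable_map w.param).iterate q

instance isProbabilityMeasure_avgLebesgue (n : ℕ) : IsProbabilityMeasure (w.avgLebesgue n) := by
  constructor
  have : ∀ q, (Measure.map w.T^[q] lebesgue) Set.univ = 1 := fun q => by
    rw [Measure.map_apply (w.measurable_iterate q) MeasurableSet.univ]; simp
  rw [avgLebesgue, Measure.smul_apply, Measure.finsetSum_apply]
  simp only [this, Finset.sum_const, Finset.card_range, nsmul_eq_mul, mul_one]
  rw [ENNReal.smul_def, smul_eq_mul, ENNReal.coe_inv (by positivity), ENNReal.coe_natCast,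
    ENNReal.inv_mul_cancel (by simp) (by simp)]

theorem integral_avgLebesgue {f : I → ℝ} (hf : Continuous f) {B : ℝ} (hB : ∀ x, |f x| ≤ B)
    (n : ℕ) : ∫ x, f x ∂w.avgLebesgue n =
      ((n + 1 : ℕ) : ℝ)⁻¹ * ∑ q ∈ Finset.range (n + 1), ∫ x, f (w.T^[q] x) ∂lebesgue := by
  have : ∀ q, IsProbabilityMeasure (Measure.map w.T^[q] lebesgue) := fun q =>
    Measure.isProbabilityMeasure_map (w.measurable_iterate q).aemeasurable
  rw [avgLebesgue, integral_smul_nnreal_measure, integral_finsetSum_measure]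
  · rw [NNReal.smul_def, smul_eq_mul]
    push_cast
    congr 1
    refine Finset.sum_congr rfl fun q _ => ?_
    rw [integral_map (w.measurable_iterate q).aemeasurable hf.measurable.aestronglyMeasurable]
  · intro q _
    exact Integrable.of_bound hf.measurable.aestronglyMeasurable B
      (Eventually.of_forall fun x => hB _)

theorem isLimitOfLebesgue : IsLimitOfLebesgue w.T w.mu := by
  intro f
  let ρ : ℕ → ProbabilityMeasure I := fun n => ⟨w.avgLebesgue n, inferInstance⟩
  let μ' : ProbabilityMeasure I := ⟨w.mu, w.isProbabilityMeasure_mu⟩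
  have h : Tendsto ρ atTop (𝓝 μ') := by
    rw [tendsto_iff_forall_lipschitz_integral_tendsto]
    rintro f hf ⟨K, hK⟩
    obtain ⟨B, hB⟩ := exists_bound_of_dist hf
    have h1 := w.tendsto_average_integral hK hB lebesgue w.mu w.measurePreserving_map
    refine ((tendsto_add_atTop_iff_nat 1).2 h1).congr fun n => ?_
    exact (w.integral_avgLebesgue hK.continuous hB n).symm
  rw [ProbabilityMeasure.tendsto_iff_forall_integral_tendsto] at h
  refine (tendsto_add_atTop_iff_nat 1).1 ((h f).congr fun n => ?_)
  exact w.integral_avgLebesgue f.continuous (fun x => f.norm_coe_le_norm x) n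

end Widths

/-! ### Spectral properties of extensions of a rotation -/

section Factor

variable {X : Type*} [MeasurableSpace X] {T : X → X} {μ : Measure X} {φ : X → UnitAddCircle} {γ : ℝ}

theorem volume_unitAddCircle : (volume : Measure UnitAddCircle) = AddCircle.haarAddCircle := by
  rw [AddCircle.volume_eq_smul_haarAddCircle]; simp

theorem fourier_factor (hφT : ∀ᵐ x ∂μ, φ (T x) = rotation γ (φ x)) (n : ℤ) :
    ∀ᵐ x ∂μ, fourier n (φ (T x)) = fourier n (γ : UnitAddCircle) * fourier n (φ x) := by
  filter_upwards [hφT] with x hx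
  rw [hx, rotation, fourier_apply, fourier_apply, fourier_apply, smul_add,
    AddCircle.toCircle_add, Circle.coe_mul, mul_comm]

theorem isMeasurableEigenvalue_of_factor [NeZero μ] (hφ : Measurable φ)
    (hφT : ∀ᵐ x ∂μ, φ (T x) = rotation γ (φ x)) :
    IsMeasurableEigenvalue T μ (Complex.exp (2 * (Real.pi : ℂ) * Complex.I * (γ : ℂ))) := by
  refine ⟨fun x => fourier 1 (φ x), (fourier 1).continuous.measurable.comp hφ, fun h => ?_, ?_⟩
  · have : ∀ᵐ _x ∂μ, False := by
      filter_upwards [h] with x hx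
      have h1 : ‖(fourier 1 (φ x) : ℂ)‖ = 1 := by rw [fourier_apply]; exact Circle.norm_coe _
      rw [hx] at h1
      simp at h1
    exact this.exists.elim fun _ h => h
  · filter_upwards [fourier_factor hφT 1] with x hx
    rw [hx, fourier_coe_apply]
    simp

/-- Pulled-back characters are eigenfunctions, characters span a dense subspace on the circle, and
the isometry `L` is onto because `ψ` inverts `φ` almost everywhere. -/
theorem hasDiscreteSpectrum_of_isomorphism {ψ : UnitAddCircle → X} (hT : MeasurePreserving T μ μ)
    (hφ : MeasurePreserving φ μ volume) (hψ : MeasurePreserving ψ volume μ)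
    (hφT : ∀ᵐ x ∂μ, φ (T x) = rotation γ (φ x)) (hinv : ∀ᵐ x ∂μ, ψ (φ x) = x) :
    HasDiscreteSpectrum T μ := by
  rw [volume_unitAddCircle] at hφ hψ
  let L : Lp ℂ 2 (AddCircle.haarAddCircle (T := 1)) →ₗᵢ[ℂ] Lp ℂ 2 μ :=
    Lp.compMeasurePreservingₗᵢ ℂ φ hφ
  let S := Submodule.span ℂ {f : Lp ℂ 2 μ | ∃ c : ℂ, ∀ᵐ x ∂μ, f (T x) = c * f x}
  have hL : ∀ n : ℤ, L (fourierLp 2 n) ∈ S := by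
    intro n
    refine Submodule.subset_span ⟨fourier n (γ : UnitAddCircle), ?_⟩
    have h1 : ∀ᵐ x ∂μ, L (fourierLp 2 n) x = fourier n (φ x) := by
      filter_upwards [Lp.coeFn_compMeasurePreserving (fourierLp 2 n) hφ,
        hφ.quasiMeasurePreserving.ae (coeFn_fourierLp 2 n)] with x hx hx'
      exact hx.trans hx'
    filter_upwards [h1, hT.quasiMeasurePreserving.ae h1, fourier_factor hφT n] with x hx hx' hx''
    rw [hx, hx', hx'']
  have hcomap : S.topologicalClosure.comap L.toLinearMap = ⊤ := by
    rw [eq_top_iff, ← span_fourierLp_closure_eq_top (T := 1) (p := 2) (by simp)]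
    refine Submodule.topologicalClosure_minimal _ ?_ ?_
    · rw [Submodule.span_le]
      rintro _ ⟨n, rfl⟩
      exact S.le_topologicalClosure (hL n)
    · exact S.isClosed_topologicalClosure.preimage L.continuous
  change S.topologicalClosure = ⊤
  rw [eq_top_iff]
  intro f _
  let g : Lp ℂ 2 (AddCircle.haarAddCircle (T := 1)) := Lp.compMeasurePreserving ψ hψ f
  have hg : L g = f := by
    refine Lp.ext ?_
    filter_upwards [Lp.coeFn_compMeasurePreserving g hφ,
      hφ.quasiMeasurePreserving.ae (Lp.coeFn_compMeasurePreserving f hψ), hinv] with x hx hx' hx''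
    refine hx.trans (hx'.trans ?_)
    simp [hx'']
  rw [← hg]
  have : g ∈ S.topologicalClosure.comap L.toLinearMap := hcomap ▸ Submodule.mem_top
  exact this

theorem not_isWeaklyMixing_of_factor [IsProbabilityMeasure μ]
    (hφ : MeasurePreserving φ μ volume) (hφT : ∀ᵐ x ∂μ, φ (T x) = rotation γ (φ x)) :
    ¬ IsWeaklyMixing T μ := by
  intro h
  rw [volume_unitAddCircle] at hφ
  let e : X → ℂ := fun x => fourier 1 (φ x)
  let e' : X → ℂ := fun x => fourier (-1) (φ x)
  have he : Measurable e := (fourier 1).continuous.measurable.comp hφ.measurable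
  have he' : Measurable e' := (fourier (-1)).continuous.measurable.comp hφ.measurable
  -- The two eigenvalues cancel, so `g` is invariant under `T × T`. Ergodicity would make it a
  -- constant of modulus one, yet its integral is zero.
  let g : X × X → ℂ := fun z => e z.1 * e' z.2
  have hg : Measurable g := (he.comp measurable_fst).mul (he'.comp measurable_snd)
  have hinv : g ∘ Prod.map T T =ᵐ[μ.prod μ] g := by
    filter_upwards [Measure.quasiMeasurePreserving_fst.ae (fourier_factor hφT 1),
      Measure.quasiMeasurePreserving_snd.ae (fourier_factor hφT (-1))] with z h1 h2
    have h3 : (fourier 1 (γ : UnitAddCircle) : ℂ) * fourier (-1) (γ : UnitAddCircle) = 1 := by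
      rw [← fourier_add]; simp
    change (fourier 1 (φ (T z.1)) : ℂ) * fourier (-1) (φ (T z.2)) =
      fourier 1 (φ z.1) * fourier (-1) (φ z.2)
    rw [h1, h2]
    linear_combination (fourier 1 (φ z.1) * fourier (-1) (φ z.2) : ℂ) * h3
  obtain ⟨c, hc⟩ := h.ae_eq_const_of_ae_eq_comp_ae hg.aestronglyMeasurable hinv
  have hnorm : ∀ (n : ℤ) (y : UnitAddCircle), ‖(fourier n y : ℂ)‖ = 1 := fun n y => by
    rw [fourier_apply]; exact Circle.norm_coe _
  have hc1 : ‖c‖ = 1 := by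
    obtain ⟨z, hz⟩ := hc.exists
    rw [Function.const_apply] at hz
    rw [← hz, norm_mul, hnorm, hnorm, one_mul]
  have hint : ∫ z, g z ∂(μ.prod μ) = c := by
    rw [integral_congr_ae hc]; simp
  have hzero : ∫ x, e x ∂μ = 0 := by
    have h1 : ∫ y, (fourier 1 y : ℂ) ∂(AddCircle.haarAddCircle (T := 1)) = 0 :=
      integral_eq_zero_of_add_right_eq_neg (μ := AddCircle.haarAddCircle)
        (fourier_add_half_inv_index one_ne_zero one_pos)
    rw [← hφ.map_eq, integral_map hφ.measurable.aemeasurable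
      (fourier 1).continuous.measurable.aestronglyMeasurable] at h1
    exact h1
  rw [integral_prod_mul e e', hzero, zero_mul] at hint
  rw [← hint] at hc1
  simp at hc1

end Factor

end BTITM

/-! ### Assembly of the theorem -/

theorem mainTheorem3 :
    ∃ p : BTITM.Param,
      BTITM.IsInfiniteType p.map ∧
      ∃ μ : Measure BTITM.I,
        IsProbabilityMeasure μ ∧
        MeasurePreserving p.map μ μ ∧
        (∀ ν : Measure BTITM.I, IsProbabilityMeasure ν → MeasurePreserving p.map ν ν → ν = μ) ∧
        BTITM.IsLimitOfLebesgue p.map μ ∧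
        (∃ γ : ℝ, Irrational γ ∧
          BTITM.MeasureIsomorphic p.map μ (BTITM.rotation γ) (volume : Measure UnitAddCircle) ∧
          BTITM.IsMeasurableEigenvalue p.map μ
            (Complex.exp (2 * (Real.pi : ℂ) * Complex.I * (γ : ℂ)))) ∧
        BTITM.HasDiscreteSpectrum p.map μ ∧
        ¬ BTITM.IsWeaklyMixing p.map μ := by
  obtain ⟨w⟩ := BTITM.nonempty_widths
  obtain ⟨φ, hφ, hX, hX0, hTX, hinv, hφT⟩ := w.exists_isomorphism
  have hae : ∀ᵐ x ∂w.mu, x ∈ w.sec '' BTITM.fullSet := by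
    rw [ae_iff]; exact hX0
  have hφT' : ∀ᵐ x ∂w.mu, φ (w.T x) = BTITM.rotation BTITM.gam (φ x) := hae.mono hφT
  have hinvOn : Set.InvOn w.sec φ (w.sec '' BTITM.fullSet) BTITM.fullSet := by
    refine ⟨?_, hinv⟩
    rintro _ ⟨y, hy, rfl⟩
    rw [hinv y hy]
  have hmaps : Set.MapsTo φ (w.sec '' BTITM.fullSet) BTITM.fullSet := by
    rintro _ ⟨y, hy, rfl⟩
    rwa [hinv y hy]
  refine ⟨w.param, w.isInfiniteType, w.mu, w.isProbabilityMeasure_mu, w.measurePreserving_map,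
    w.eq_mu, w.isLimitOfLebesgue, ⟨BTITM.gam, BTITM.irrational_gam, ?_, ?_⟩, ?_, ?_⟩
  · exact ⟨_, _, φ, w.sec, hX, BTITM.measurableSet_fullSet, hX0, BTITM.volume_compl_fullSet, hTX,
      BTITM.mapsTo_fullSet, hφ, w.measurePreserving_sec, hmaps, Set.mapsTo_image _ _, hinvOn, hφT⟩
  · exact BTITM.isMeasurableEigenvalue_of_factor hφ.measurable hφT'
  · exact BTITM.hasDiscreteSpectrum_of_isomorphism w.measurePreserving_map hφ
      w.measurePreserving_sec hφT' (hae.mono hinvOn.1)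
  · exact BTITM.not_isWeaklyMixing_of_factor hφ hφT'
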